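/- **Setting.** $\mathbb T=\mathbb R/2\pi\mathbb Z$, $I^+=(0,1)$, $I^-=(-1,0)$, $\mathbb R^\pm=\{\pm Y_3>0\}$. Repeated indices are summed, $j\in\{1,2\}$, $\alpha\in\{1,2,3\}$. Vectors of $\mathbb R^7$ are written $U=(u_1,u_2,u_3,H_1,H_2,H_3,q)$. Fix two states $U^{0,\pm}=(u_1^{0,\pm},u_2^{0,\pm},0,H_1^{0,\pm},H_2^{0,\pm},0,0)$, $\tau\in\mathbb R$, $\xi=(\xi_1,\xi_2)\in\mathbb R^2$, and set $a^\pm=\xi_ju_j^{0,\pm}$, $b^\pm=\xi_jH_j^{0,\pm}$, $c^\pm=\tau+a^\pm$, $[u^0]=u^{0,+}-u^{0,-}$. Assume $|H^{0,+}\times[u^0]|^2+|H^{0,-}\times[u^0]|^2<2|H^{0,+}\times H^{0,-}|^2$; $\xi=(p,q)/\sqrt{p^2+q^2}$ with $(p,q)\in\mathbb Z^2\setminus\{0\}$; $|a^+-a^-|\ne|b^+-b^-|$ and $|a^+-a^-|\neq|b^++b^-|$; $(c^+)^2+(c^-)^2=(b^+)^2+(b^-)^2$; $\tau\ne0$. Let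 $\chi\in C^\infty(\mathbb R)$ with $\chi=1$ on $[-1/3,1/3]$ and $\chi=0$ outside $[-2/3,2/3]$. Let $f_\alpha$ be the fluxes of the incompressible MHD system in conservative form, that is $f_\alpha(U)=\big((u_\alpha u_\beta-H_\alpha H_\beta+q\,\delta_{\alpha\beta})_{\beta=1,2,3},\ (u_\alpha H_\beta-H_\alpha u_\beta)_{\beta=1,2,3},\ u_\alpha\big)$, and $A_\alpha^\pm=df_\alpha(U^{0,\pm})$, $\mathbb A_\alpha=d^2f_\alpha$, $A_0=\mathrm{diag}(1,1,1,1,1,1,0)$, $\mathcal A^\pm=\tau A_0+\xi_jA_j^\pm$, $\mathcal L_f^\pm(\partial)=A_3^\pm\partial_{Y_3}+\mathcal A^\pm\partial_\theta$, $L_s^\pm(\partial)=A_0\partial_t+A_\alpha^\pm\partial_{y_\alpha}$. **Profiles.** Let $T>0$. Front profiles $\psi^\ell(t,y',\theta)$ belong to $H^\infty([0,T]\times\mathbb T^2\times\mathbb T)$, with $y'=(y_1,y_2)$. Bulk profiles $U^{\ell,\pm}(t,y,Y_3,\theta)$, $y=(y',y_3)$, belong to $S^\pm=\underline S^\pm\oplus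 S^\pm_\star$ (componentwise), where $\underline S^\pm=H^\infty([0,T]\times\mathbb T^2\times I^\pm\times\mathbb T)$ and $S_\star^\pm$ is the set of functions of $H^\infty([0,T]\times\mathbb T^2\times I^\pm\times\mathbb R^\pm\times\mathbb T)$ for which there is $\delta>0$ such that every derivative $\partial^\alpha$ is bounded by $C_\alpha e^{\mp\delta Y_3}$. We write $U=\underline U+U_\star$ for this decomposition, and use the same notation for functions built from profiles. $\widehat f(k)$ is the $k$-th Fourier coefficient in $\theta$. Elements of these spaces are identified with their representatives that are smooth up to the boundary. By convention $\psi^0=\psi^1=0$, and $U^{0,\pm}$ is the constant state above. Let $\chi^{[m]}(t,y,\theta)$, $\dot\chi^{[m]}(t,y,\theta)$, $\mathcal J^m(t,y,\theta)$ be the coefficients of $\varepsilon^m$ in the formal power series $\chi(x_3)$, $\chi'(x_3)$, $\big(1-\chi'(x_3)\sum_\ell\varepsilon^\ell\psi^\ell\big)^{-1}$, where $x_3=y_3+O(\varepsilon)$ is the formal solution of $y_3=x_3-\chi(x_3)\sum_\ell\varepsilon^\ell\psi^\ell(t,y',\theta)$. **Source terms.** All indices $\ell_i$ are nonnegative integers.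 For $m\ge0$ put (superscripts $\pm$ omitted on $U$) $$\begin{aligned}F^{m,\pm}={}&-L_s^\pm(\partial)U^{m}+\sum_{\ell_1+\ell_2=m+2}\partial_\theta\psi^{\ell_1}\mathcal A^\pm\partial_{Y_3}U^{\ell_2}+\sum_{\ell_1+\ell_2=m+1}(\partial_t\psi^{\ell_1}A_0+\partial_{y_j}\psi^{\ell_1}A_j^\pm)\partial_{Y_3}U^{\ell_2}\\&+\sum_{\ell_1+\ell_2+\ell_3=m+1}\chi^{[\ell_1]}\partial_\theta\psi^{\ell_2}\mathcal A^\pm\partial_{y_3}U^{\ell_3}+\sum_{\ell_1+\ell_2+\ell_3=m}\chi^{[\ell_1]}(\partial_t\psi^{\ell_2}A_0+\partial_{y_j}\psi^{\ell_2}A_j^\pm)\partial_{y_3}U^{\ell_3}\\&+\sum_{\ell_1+\ell_2+\ell_3=m}\dot\chi^{[\ell_1]}\psi^{\ell_2}A_3^\pm\partial_{y_3}U^{\ell_3}-\sum_{\substack{\ell_1+\ell_2=m\\\ell_1,\ell_2\ge1}}\mathbb A_\alpha(U^{\ell_1},\partial_{y_\alpha}U^{\ell_2})\\&-\sum_{\substack{\ell_1+\ell_2=m+1\\\ell_1,\ell_2\ge1}}\big(\xi_j\mathbb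 A_j(U^{\ell_1},\partial_\theta U^{\ell_2})+\mathbb A_3(U^{\ell_1},\partial_{Y_3}U^{\ell_2})\big)\\&+\sum_{\substack{\ell_1+\ell_2+\ell_3=m+2\\\ell_2,\ell_3\ge1}}\partial_\theta\psi^{\ell_1}\xi_j\mathbb A_j(U^{\ell_2},\partial_{Y_3}U^{\ell_3})+\sum_{\substack{\ell_1+\ell_2+\ell_3=m+1\\\ell_2,\ell_3\ge1}}\partial_{y_j}\psi^{\ell_1}\mathbb A_j(U^{\ell_2},\partial_{Y_3}U^{\ell_3})\\&+\sum_{\substack{\ell_1+\cdots+\ell_4=m+1\\\ell_3,\ell_4\ge1}}\chi^{[\ell_1]}\partial_\theta\psi^{\ell_2}\xi_j\mathbb A_j(U^{\ell_3},\partial_{y_3}U^{\ell_4})\\&+\sum_{\substack{\ell_1+\cdots+\ell_4=m\\\ell_3,\ell_4\ge1}}\big(\chi^{[\ell_1]}\partial_{y_j}\psi^{\ell_2}\mathbb A_j(U^{\ell_3},\partial_{y_3}U^{\ell_4})+\dot\chi^{[\ell_1]}\psi^{\ell_2}\mathbb A_3(U^{\ell_3},\partial_{y_3}U^{\ell_4})\big),\end{aligned}$$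 $$\begin{aligned}F_8^{m,\pm}={}&-\nabla\cdot H^{m}+\sum_{\ell_1+\ell_2=m+2}\partial_\theta\psi^{\ell_1}\xi_j\partial_{Y_3}H_j^{\ell_2}+\sum_{\ell_1+\ell_2=m+1}\partial_{y_j}\psi^{\ell_1}\partial_{Y_3}H_j^{\ell_2}+\sum_{\ell_1+\ell_2+\ell_3=m+1}\chi^{[\ell_1]}\partial_\theta\psi^{\ell_2}\xi_j\partial_{y_3}H_j^{\ell_3}\\&+\sum_{\ell_1+\ell_2+\ell_3=m}\big(\chi^{[\ell_1]}\partial_{y_j}\psi^{\ell_2}\partial_{y_3}H_j^{\ell_3}+\dot\chi^{[\ell_1]}\psi^{\ell_2}\partial_{y_3}H_3^{\ell_3}\big),\end{aligned}$$ $$G_1^{m,\pm}=\partial_t\psi^{m+1}+u_j^{0,\pm}\partial_{y_j}\psi^{m+1}+\sum_{\substack{\ell_1+\ell_2=m+2\\\ell_2\ge1}}\partial_\theta\psi^{\ell_1}\xi_ju_j^{\ell_2,\pm}|_{y_3=Y_3=0}+\sum_{\substack{\ell_1+\ell_2=m+1\\\ell_2\ge1}}\partial_{y_j}\psi^{\ell_1}u_j^{\ell_2,\pm}|_{y_3=Y_3=0},$$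 $$G_2^{m,\pm}=H_j^{0,\pm}\partial_{y_j}\psi^{m+1}+\sum_{\substack{\ell_1+\ell_2=m+2\\\ell_2\ge1}}\partial_\theta\psi^{\ell_1}\xi_jH_j^{\ell_2,\pm}|_{y_3=Y_3=0}+\sum_{\substack{\ell_1+\ell_2=m+1\\\ell_2\ge1}}\partial_{y_j}\psi^{\ell_1}H_j^{\ell_2,\pm}|_{y_3=Y_3=0}.$$ The residual components $\underline F^{m,\pm}$, $\underline F_8^{m,\pm}$ are given by the same formulas with $\underline U$ in place of $U$. $F_i^{m,\pm}$ is the $i$-th component of $F^{m,\pm}$. **Induction hypothesis $H(m)$, $m\ge1$.** The profiles $(U^{1,\pm},\psi^2),\dots,(U^{m-1,\pm},\psi^m),(U^{m,\pm},\psi^{m+1}_\sharp)$ belong to $S^\pm\times H^\infty([0,T]\times\mathbb T^3)$, $\psi_\sharp^{m+1}$ has zero mean in $\theta$, and, using $\psi^{m+1}_\sharp$ for $\psi^{m+1}$: 1. for $1\le\mu\le m$, in $\{t\in[0,T],\,y_3\in I^\pm,\ \pm Y_3>0\}$: $\mathcal L_f^\pm(\partial)U^{\mu,\pm}=F^{\mu-1,\pm}$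 and $\partial_{Y_3}H_3^{\mu,\pm}+\xi_j\partial_\theta H_j^{\mu,\pm}=F_8^{\mu-1,\pm}$; and at $y_3=Y_3=0$: $u_3^{\mu,\pm}-c^\pm\partial_\theta\psi^{\mu+1}=G_1^{\mu-1,\pm}$, $H_3^{\mu,\pm}-b^\pm\partial_\theta\psi^{\mu+1}=G_2^{\mu-1,\pm}$, $q^{\mu,+}-q^{\mu,-}=0$; 2. for $1\le\mu\le m$: $\underline u_3^{\mu,\pm}=\underline H_3^{\mu,\pm}=0$ at $y_3=\pm1$; 3. for $1\le\mu\le m$ and $t\in[0,T]$: $\mathcal I^\mu(t)=0$, where $\mathcal I^\mu(t)$ is the sum over the two signs $\pm$ of $$\int_{\mathbb T^2\times I^\pm}\widehat{\underline q}^{\mu,\pm}(t,y,0)\,dy+\sum_{\substack{\ell_1+\ell_2=\mu-1\\\ell_1\ge1}}\frac1{\ell_2!}\int_{\mathbb T^2\times\mathbb R^\pm}Y_3^{\ell_2}\,\partial_{y_3}^{\ell_2}\widehat q_\star^{\ell_1,\pm}(t,y',0,Y_3,0)\,dy'dY_3+\sum_{\substack{\ell_1+\ell_2=\mu\\\ell_1\ge1,\ell_2\ge2}}\int_{\mathbb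 T^2\times I^\pm}\int_{\mathbb T}\underline q^{\ell_1,\pm}\mathcal J^{\ell_2}\,dy\frac{d\theta}{2\pi};$$ 4. $\widehat{\underline F}^{m,\pm}(0)=0$ and $\widehat{\underline F}_8^{m,\pm}(0)=0$; 5. for $j=1,2$: $u_j^{0,\pm}\widehat F^{m,\pm}_{7,\star}(0)-H_j^{0,\pm}\widehat F^{m,\pm}_{8,\star}(0)=\widehat F^{m,\pm}_{j,\star}(0)$ and $H_j^{0,\pm}\widehat F^{m,\pm}_{7,\star}(0)-u_j^{0,\pm}\widehat F^{m,\pm}_{8,\star}(0)=\widehat F^{m,\pm}_{3+j,\star}(0)$; 6. for every integer $k\ne0$ and all $(t,y')$: $$\int_{\mathbb R^+}e^{-|k|Y_3}\,\overline{\mathcal L^+(k)}\cdot\widehat F^{m,+}(t,y',0,Y_3,k)\,dY_3-\int_{\mathbb R^-}e^{|k|Y_3}\,\overline{\mathcal L^-(k)}\cdot\widehat F^{m,-}(t,y',0,Y_3,k)\,dY_3+\sum_{\pm}\big(\ell_1^\pm\widehat G_1^{m,\pm}(k)+\ell_2^\pm\widehat G_2^{m,\pm}(k)\big)=0,$$ with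 $\mathcal L^\pm(k)=(\xi_1\tau,\xi_2\tau,\pm i\,\mathrm{sgn}(k)\tau,2\xi_1b^\pm,2\xi_2b^\pm,\pm2i\,\mathrm{sgn}(k)b^\pm,-\tau(a^\pm+c^\pm))$, $\ell_1^\pm=2(b^\pm)^2-\tau c^\pm$, $\ell_2^\pm=-(a^\pm+c^\pm)b^\pm$. **Claim.** Assume $H(m)$ for some $T>0$ and $m\ge1$. Then for every $\psi^{m+1}\in H^\infty([0,T]\times\mathbb T^2\times\mathbb T)$ whose oscillating part $\psi^{m+1}-\widehat\psi^{m+1}(0)$ is $\psi_\sharp^{m+1}$ (that is, whatever the $\theta$-mean of $\psi^{m+1}$), the source terms computed with this $\psi^{m+1}$ satisfy, on both sides $\pm$ and for all $(t,y',\theta)\in[0,T]\times\mathbb T^2\times\mathbb T$, $$F_6^{m,\pm}|_{y_3=Y_3=0}=-b^\pm\,\partial_\theta G_1^{m,\pm}+c^\pm\,\partial_\theta G_2^{m,\pm}.$$ -/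

import Mathlib

open scoped Nat ContDiff Matrix

noncomputable section

/-! ### The two sides of the sheet, the reference state and the frequencies -/

/-- The two sides of the current vortex sheet (the superscript `±`). -/
inductive Side where
  | plus
  | minus

/-- The sign `±1` attached to a side. -/
def Side.sgn : Side → ℝ
  | .plus => 1
  | .minus => -1

/-- The planar piecewise constant current vortex sheet (tangential velocities `u0 s = (u₁⁰, u₂⁰)` and
tangential magnetic fields `H0 s = (H₁⁰, H₂⁰)` on both sides) and the frequencies `(τ, ξ₁, ξ₂)`. -/
structure SheetData where
  u0 : Side → Fin 2 → ℝ
  H0 : Side → Fin 2 → ℝ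
  τ : ℝ
  ξ : Fin 2 → ℝ

namespace SheetData

/-- `a^± = ξ₁ u₁^{0,±} + ξ₂ u₂^{0,±}` -/
def a (P : SheetData) (s : Side) : ℝ := ∑ j, P.ξ j * P.u0 s j

/-- `b^± = ξ₁ H₁^{0,±} + ξ₂ H₂^{0,±}` -/
def b (P : SheetData) (s : Side) : ℝ := ∑ j, P.ξ j * P.H0 s j

/-- `c^± = τ + a^±` -/
def c (P : SheetData) (s : Side) : ℝ := P.τ + P.a s

/-- The constant state `U^{0,±} = (u₁⁰, u₂⁰, 0, H₁⁰, H₂⁰, 0, 0)`. -/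
def refState (P : SheetData) (s : Side) : Fin 7 → ℝ :=
  ![P.u0 s 0, P.u0 s 1, 0, P.H0 s 0, P.H0 s 1, 0, 0]

/-- `|v × w|²` for two vectors of the plane, seen as horizontal vectors of `ℝ³`. -/
def crossSq (v w : Fin 2 → ℝ) : ℝ :=
  (crossProduct ![v 0, v 1, 0] ![w 0, w 1, 0]) ⬝ᵥ (crossProduct ![v 0, v 1, 0] ![w 0, w 1, 0])

/-- The standing assumptions on the reference sheet and on the frequencies. -/
structure Admissible (P : SheetData) : Prop where
  /-- `|H^{0,+} × [u⁰]|² + |H^{0,-} × [u⁰]|² < 2 |H^{0,+} × H^{0,-}|²` -/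
  stability :
    crossSq (P.H0 .plus) (P.u0 .plus - P.u0 .minus)
      + crossSq (P.H0 .minus) (P.u0 .plus - P.u0 .minus)
      < 2 * crossSq (P.H0 .plus) (P.H0 .minus)
  /-- `ξ' = (p, q) / √(p² + q²)` with `(p, q) ∈ ℤ² ∖ {0}` -/
  rational : ∃ p q : ℤ, (p, q) ≠ (0, 0) ∧
    P.ξ = ![(p : ℝ) / Real.sqrt ((p : ℝ) ^ 2 + (q : ℝ) ^ 2),
            (q : ℝ) / Real.sqrt ((p : ℝ) ^ 2 + (q : ℝ) ^ 2)]
  nondeg_sub : |P.a .plus - P.a .minus| ≠ |P.b .plus - P.b .minus|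
  nondeg_add : |P.a .plus - P.a .minus| ≠ |P.b .plus + P.b .minus|
  lopatinskii : P.c .plus ^ 2 + P.c .minus ^ 2 = P.b .plus ^ 2 + P.b .minus ^ 2
  tau_ne_zero : P.τ ≠ 0

/-! ### The matrices of the system

Vectors of `ℝ⁷` are `(u₁, u₂, u₃, H₁, H₂, H₃, q)`. -/

/-- `A₀ = diag (1, 1, 1, 1, 1, 1, 0)` -/
def A0 : Matrix (Fin 7) (Fin 7) ℝ := Matrix.diagonal ![1, 1, 1, 1, 1, 1, 0]

/-- The Jacobian matrices `A₁^±, A₂^±, A₃^±` (for `α = 0, 1, 2`) at `U^{0,±}` of the fluxes of the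
incompressible MHD system in conservative form. -/
def A (P : SheetData) (s : Side) : Fin 3 → Matrix (Fin 7) (Fin 7) ℝ :=
  let u₁ := P.u0 s 0
  let u₂ := P.u0 s 1
  let H₁ := P.H0 s 0
  let H₂ := P.H0 s 1
  ![!![2 * u₁, 0, 0, -2 * H₁, 0, 0, 1;
       u₂, u₁, 0, -H₂, -H₁, 0, 0;
       0, 0, u₁, 0, 0, -H₁, 0;
       0, 0, 0, 0, 0, 0, 0;
       H₂, -H₁, 0, -u₂, u₁, 0, 0;
       0, 0, -H₁, 0, 0, u₁, 0;
       1, 0, 0, 0, 0, 0, 0],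
    !![u₂, u₁, 0, -H₂, -H₁, 0, 0;
       0, 2 * u₂, 0, 0, -2 * H₂, 0, 1;
       0, 0, u₂, 0, 0, -H₂, 0;
       -H₂, H₁, 0, u₂, -u₁, 0, 0;
       0, 0, 0, 0, 0, 0, 0;
       0, 0, -H₂, 0, 0, u₂, 0;
       0, 1, 0, 0, 0, 0, 0],
    !![0, 0, u₁, 0, 0, -H₁, 0;
       0, 0, u₂, 0, 0, -H₂, 0;
       0, 0, 0, 0, 0, 0, 1;
       0, 0, H₁, 0, 0, -u₁, 0;
       0, 0, H₂, 0, 0, -u₂, 0;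
       0, 0, 0, 0, 0, 0, 0;
       0, 0, 1, 0, 0, 0, 0]]

/-- `𝒜^± = τ A₀ + ξ₁ A₁^± + ξ₂ A₂^±` -/
def calA (P : SheetData) (s : Side) : Matrix (Fin 7) (Fin 7) ℝ :=
  P.τ • A0 + ∑ j : Fin 2, P.ξ j • P.A s j.castSucc

/-- The vector `-(c⁺, b⁺, c⁻, b⁻, 0)`. -/
def bVec (P : SheetData) : Fin 5 → ℝ :=
  -![P.c .plus, P.b .plus, P.c .minus, P.b .minus, 0]

/-- The coefficient `ℓ₁^±`. -/
def ell1 (P : SheetData) (s : Side) : ℝ := 2 * P.b s ^ 2 - P.τ * P.c s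

/-- The coefficient `ℓ₂^±`. -/
def ell2 (P : SheetData) (s : Side) : ℝ := -(P.a s + P.c s) * P.b s

/-- The vectors `ℒ^±(k) ∈ ℂ⁷`, `k ≠ 0`. -/
def calL (P : SheetData) (s : Side) (k : ℤ) : Fin 7 → ℂ :=
  ![(P.ξ 0 * P.τ : ℝ), (P.ξ 1 * P.τ : ℝ), Complex.I * (s.sgn * k.sign * P.τ : ℝ),
    (2 * P.ξ 0 * P.b s : ℝ), (2 * P.ξ 1 * P.b s : ℝ), Complex.I * (2 * s.sgn * k.sign * P.b s : ℝ),
    (-(P.τ * (P.a s + P.c s)) : ℝ)]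

end SheetData

/-- The fluxes `f₁, f₂, f₃` of the incompressible MHD system in conservative form. -/
def flux (α : Fin 3) (U : Fin 7 → ℝ) : Fin 7 → ℝ :=
  let u₁ := U 0
  let u₂ := U 1
  let u₃ := U 2
  let H₁ := U 3
  let H₂ := U 4
  let H₃ := U 5
  let q := U 6
  ![![u₁ ^ 2 - H₁ ^ 2 + q, u₁ * u₂ - H₁ * H₂, u₁ * u₃ - H₁ * H₃,
      0, u₁ * H₂ - H₁ * u₂, u₁ * H₃ - H₁ * u₃, u₁],
    ![u₂ * u₁ - H₂ * H₁, u₂ ^ 2 - H₂ ^ 2 + q, u₂ * u₃ - H₂ * H₃,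
      u₂ * H₁ - H₂ * u₁, 0, u₂ * H₃ - H₂ * u₃, u₂],
    ![u₃ * u₁ - H₃ * H₁, u₃ * u₂ - H₃ * H₂, u₃ ^ 2 - H₃ ^ 2 + q,
      u₃ * H₁ - H₃ * u₁, u₃ * H₂ - H₃ * u₂, 0, u₃]] α

/-- The symmetric bilinear maps `𝔸_α = d²f_α`. -/
def hess (α : Fin 3) (U V : Fin 7 → ℝ) : Fin 7 → ℝ :=
  ![![2 * U 0 * V 0 - 2 * U 3 * V 3,
      U 0 * V 1 + U 1 * V 0 - U 3 * V 4 - U 4 * V 3,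
      U 0 * V 2 + U 2 * V 0 - U 3 * V 5 - U 5 * V 3,
      0,
      U 0 * V 4 + U 4 * V 0 - U 1 * V 3 - U 3 * V 1,
      U 0 * V 5 + U 5 * V 0 - U 2 * V 3 - U 3 * V 2,
      0],
    ![U 1 * V 0 + U 0 * V 1 - U 4 * V 3 - U 3 * V 4,
      2 * U 1 * V 1 - 2 * U 4 * V 4,
      U 1 * V 2 + U 2 * V 1 - U 4 * V 5 - U 5 * V 4,
      U 1 * V 3 + U 3 * V 1 - U 4 * V 0 - U 0 * V 4,
      0,
      U 1 * V 5 + U 5 * V 1 - U 4 * V 2 - U 2 * V 4,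
      0],
    ![U 2 * V 0 + U 0 * V 2 - U 5 * V 3 - U 3 * V 5,
      U 2 * V 1 + U 1 * V 2 - U 5 * V 4 - U 4 * V 5,
      2 * U 2 * V 2 - 2 * U 5 * V 5,
      U 2 * V 3 + U 3 * V 2 - U 5 * V 0 - U 0 * V 5,
      U 2 * V 4 + U 4 * V 2 - U 5 * V 1 - U 1 * V 5,
      0,
      0]] α

/-- The fluxes are quadratic polynomials with differential `A_α^±` at `U^{0,±}` and Hessian `𝔸_α`. -/
theorem flux_refState_add (P : SheetData) (s : Side) (α : Fin 3) (V : Fin 7 → ℝ) :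
    flux α (P.refState s + V)
      = flux α (P.refState s) + P.A s α *ᵥ V + (1 / 2 : ℝ) • hess α V V := by
  fin_cases α <;> ext i <;> fin_cases i <;>
    simp [flux, SheetData.refState, SheetData.A, hess, dotProduct,
      Fin.sum_univ_succ] <;> ring

/-- The boundary matrices `B^± ∈ ℳ_{5,7}(ℝ)`. -/
def Bmat : Side → Matrix (Fin 5) (Fin 7) ℝ
  | .plus =>
    !![0, 0, 1, 0, 0, 0, 0;
       0, 0, 0, 0, 0, 1, 0;
       0, 0, 0, 0, 0, 0, 0;
       0, 0, 0, 0, 0, 0, 0;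
       0, 0, 0, 0, 0, 0, 1]
  | .minus =>
    !![0, 0, 0, 0, 0, 0, 0;
       0, 0, 0, 0, 0, 0, 0;
       0, 0, 1, 0, 0, 0, 0;
       0, 0, 0, 0, 0, 1, 0;
       0, 0, 0, 0, 0, 0, -1]

/-! ### Variables, domains and derivatives

A bulk point is `p = (t, y₁, y₂, y₃, Y₃, θ)`, a front point is `q = (t, y₁, y₂, θ)`.  Functions on the torus
`ℝ / 2πℤ` are `2π`-periodic functions on `ℝ`. -/

/-- `[0,T] × 𝕋² × closure I^± × closure ℝ^± × 𝕋`, with `I⁺ = (0,1)` and `I⁻ = (-1,0)`. -/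
def bulkDomain (T : ℝ) (s : Side) : Set (Fin 6 → ℝ) :=
  {p | p 0 ∈ Set.Icc 0 T ∧ s.sgn * p 3 ∈ Set.Icc (0 : ℝ) 1 ∧ 0 ≤ s.sgn * p 4}

/-- `[0,T] × 𝕋² × I^± × ℝ^± × 𝕋`, with `±Y₃ > 0`. -/
def bulkInterior (T : ℝ) (s : Side) : Set (Fin 6 → ℝ) :=
  {p | p 0 ∈ Set.Icc 0 T ∧ s.sgn * p 3 ∈ Set.Ioo (0 : ℝ) 1 ∧ 0 < s.sgn * p 4}

/-- `[0,T] × 𝕋² × 𝕋` -/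
def frontDomain (T : ℝ) : Set (Fin 4 → ℝ) := {q | q 0 ∈ Set.Icc 0 T}

/-- `(t, y₁, y₂, y₃, Y₃, θ) ↦ (t, y₁, y₂, θ)` -/
def toFront (p : Fin 6 → ℝ) : Fin 4 → ℝ := ![p 0, p 1, p 2, p 5]

/-- The double trace `y₃ = Y₃ = 0`: `(t, y₁, y₂, θ) ↦ (t, y₁, y₂, 0, 0, θ)`. -/
def toBoundary (q : Fin 4 → ℝ) : Fin 6 → ℝ := ![q 0, q 1, q 2, 0, 0, q 3]

/-- Partial derivative with respect to the `i`-th variable of a function defined on the closed domain `D`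
(one-sided at the boundary of `D`). -/
def pd {n : ℕ} {E : Type*} [NormedAddCommGroup E] [NormedSpace ℝ E] (D : Set (Fin n → ℝ)) (i : Fin n)
    (f : (Fin n → ℝ) → E) (p : Fin n → ℝ) : E :=
  fderivWithin ℝ f D p (Pi.single i 1)

/-- The derivative `∂^α`, `α ∈ ℕ⁶`, of a bulk function. -/
def multiPd {E : Type*} [NormedAddCommGroup E] [NormedSpace ℝ E] (D : Set (Fin 6 → ℝ)) (α : Fin 6 → ℕ)
    (f : (Fin 6 → ℝ) → E) : (Fin 6 → ℝ) → E :=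
  (pd D 0)^[α 0] ((pd D 1)^[α 1] ((pd D 2)^[α 2]
    ((pd D 3)^[α 3] ((pd D 4)^[α 4] ((pd D 5)^[α 5] f)))))

/-- The index of `y_α` among the bulk variables, `α = 1, 2, 3`. -/
def yIdx (α : Fin 3) : Fin 6 := ![1, 2, 3] α

/-- The index of `y_j` among the front variables, `j = 1, 2`. -/
def yFrontIdx (j : Fin 2) : Fin 4 := ![1, 2] j

/-- The index of `u_j` (`j = 1, 2`) in a vector of `ℝ⁷`. -/
def uIdx (j : Fin 2) : Fin 7 := ![0, 1] j

/-- The index of `H_j` (`j = 1, 2`) in a vector of `ℝ⁷`. -/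
def HIdx (j : Fin 2) : Fin 7 := ![3, 4] j

/-- The mean over one period with respect to the `i`-th variable. -/
def mean {n : ℕ} (i : Fin n) (f : (Fin n → ℝ) → ℝ) (p : Fin n → ℝ) : ℝ :=
  (1 / (2 * Real.pi)) * ∫ x in (0 : ℝ)..(2 * Real.pi), f (Function.update p i x)

/-- The `k`-th Fourier coefficient with respect to the `i`-th variable. -/
def fourierMode {n : ℕ} (i : Fin n) (f : (Fin n → ℝ) → ℝ) (k : ℤ) (p : Fin n → ℝ) : ℂ :=
  (1 / (2 * Real.pi) : ℝ) * ∫ x in (0 : ℝ)..(2 * Real.pi),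
    (f (Function.update p i x) : ℂ) * Complex.exp (-(Complex.I * (k * x : ℝ)))

/-! ### Spaces of profiles

`H^∞` of one of these cylinders is the space of `C^∞` functions up to the boundary. -/

/-- `ψ ∈ H^∞([0,T] × 𝕋² × 𝕋)` -/
structure FrontHInf (T : ℝ) (ψ : (Fin 4 → ℝ) → ℝ) : Prop where
  smooth : ContDiffOn ℝ ∞ ψ (frontDomain T)
  periodic : ∀ i : Fin 4, i ≠ 0 → ∀ q ∈ frontDomain T, ψ (q + Pi.single i (2 * Real.pi)) = ψ q

/-- Bulk functions which are smooth up to the boundary and periodic in `y₁`, `y₂`, `θ`. -/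
structure BulkSmooth (T : ℝ) (s : Side) (f : (Fin 6 → ℝ) → Fin 7 → ℝ) : Prop where
  smooth : ContDiffOn ℝ ∞ f (bulkDomain T s)
  periodic : ∀ i : Fin 6, i = 1 ∨ i = 2 ∨ i = 5 → ∀ p ∈ bulkDomain T s,
    f (p + Pi.single i (2 * Real.pi)) = f p

/-- The space of residual profiles, which do not depend on `Y₃`. -/
structure ResidualSpace (T : ℝ) (s : Side) (f : (Fin 6 → ℝ) → Fin 7 → ℝ) : Prop extends
    BulkSmooth T s f where
  indep : ∀ p ∈ bulkDomain T s, f p = f (Function.update p 4 0)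

/-- The space of surface wave profiles, which decay exponentially in `Y₃` with all their derivatives. -/
structure SurfaceSpace (T : ℝ) (s : Side) (f : (Fin 6 → ℝ) → Fin 7 → ℝ) : Prop extends
    BulkSmooth T s f where
  decay : ∃ δ : ℝ, 0 < δ ∧ ∀ α : Fin 6 → ℕ, ∃ C : ℝ, 0 < C ∧ ∀ p ∈ bulkDomain T s,
    ‖multiPd (bulkDomain T s) α f p‖ ≤ C * Real.exp (-(δ * (s.sgn * p 4)))

/-- A family of profiles: the residual and surface wave components of `U^{ℓ,±}`, and the fronts `ψ^ℓ`. -/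
structure Profiles where
  Ures : Side → ℕ → (Fin 6 → ℝ) → Fin 7 → ℝ
  Usurf : Side → ℕ → (Fin 6 → ℝ) → Fin 7 → ℝ
  ψ : ℕ → (Fin 4 → ℝ) → ℝ

/-- `U^{ℓ,±}`, the sum of its residual and surface wave components. -/
def Profiles.U (W : Profiles) (s : Side) (ℓ : ℕ) (p : Fin 6 → ℝ) : Fin 7 → ℝ :=
  W.Ures s ℓ p + W.Usurf s ℓ p

/-! ### The cut-off function and the straightening of the front -/

/-- Smooth cut-off functions equal to `1` on `[-1/3, 1/3]` and to `0` outside of `[-2/3, 2/3]`. -/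
structure IsCutoff (χ : ℝ → ℝ) : Prop where
  smooth : ContDiff ℝ ∞ χ
  eq_one : ∀ x ∈ Set.Icc (-(1 / 3) : ℝ) (1 / 3), χ x = 1
  eq_zero : ∀ x, x ∉ Set.Icc (-(2 / 3) : ℝ) (2 / 3) → χ x = 0

/-- The coefficient of `ε^m` in the formal expansion of `g (y + ∑_{k ≥ 1} ε^k X_k)` (Faà di Bruno). -/
def faaDiBruno (g : ℝ → ℝ) (y : ℝ) (X : ℕ → ℝ) (m : ℕ) : ℝ :=
  ∑ μ : Nat.Partition m, iteratedDeriv μ.parts.card g y *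
    ∏ k ∈ Finset.Icc 1 m, X k ^ μ.parts.count k / ((μ.parts.count k)! : ℝ)

/-- The coefficients of the formal series `x₃ = ∑ ε^ℓ X_ℓ` which solves
`y = x₃ - χ(x₃) ∑_{ℓ ≥ 1} ε^ℓ a_ℓ`: `X_0 = y` and `X_{n+1} = ∑_{ℓ₁ ≤ n} χ_{ℓ₁} a_{n+1-ℓ₁}`, with `χ_ℓ` the
coefficient of `ε^ℓ` in `χ(x₃)` (which depends on `X_1, …, X_ℓ` only). -/
def straightX (χ : ℝ → ℝ) (y : ℝ) (a : ℕ → ℝ) : ℕ → ℝ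
  | 0 => y
  | n + 1 => ∑ ℓ ∈ Finset.range (n + 1),
      faaDiBruno χ y (fun k => if _h : k ≤ n then straightX χ y a k else 0) ℓ * a (n + 1 - ℓ)
termination_by n => n
decreasing_by omega

theorem faaDiBruno_congr (g : ℝ → ℝ) (y : ℝ) (X X' : ℕ → ℝ) (m : ℕ)
    (h : ∀ k ∈ Finset.Icc 1 m, X k = X' k) : faaDiBruno g y X m = faaDiBruno g y X' m := by
  unfold faaDiBruno
  refine Finset.sum_congr rfl fun μ _ => ?_
  congr 1
  exact Finset.prod_congr rfl fun k hk => by rw [h k hk]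

/-- The recursion for `X_ℓ`, without truncation. -/
theorem straightX_succ (χ : ℝ → ℝ) (y : ℝ) (a : ℕ → ℝ) (n : ℕ) :
    straightX χ y a (n + 1)
      = ∑ ℓ ∈ Finset.range (n + 1), faaDiBruno χ y (straightX χ y a) ℓ * a (n + 1 - ℓ) := by
  rw [straightX]
  refine Finset.sum_congr rfl fun l hl => ?_
  congr 1
  apply faaDiBruno_congr
  intro k hk
  simp at hl hk
  rw [dif_pos (by omega)]

/-- `χ^{[m]}(t, y, θ)`, the coefficient of `ε^m` in `χ(x₃)`. -/
def chiCoef (χ : ℝ → ℝ) (ψ : ℕ → (Fin 4 → ℝ) → ℝ) (m : ℕ) (p : Fin 6 → ℝ) : ℝ :=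
  faaDiBruno χ (p 3) (straightX χ (p 3) fun ℓ => ψ ℓ (toFront p)) m

/-- `\dot χ^{[m]}(t, y, θ)`, the coefficient of `ε^m` in `χ'(x₃)`. -/
def chiDotCoef (χ : ℝ → ℝ) (ψ : ℕ → (Fin 4 → ℝ) → ℝ) (m : ℕ) (p : Fin 6 → ℝ) : ℝ :=
  faaDiBruno (deriv χ) (p 3) (straightX χ (p 3) fun ℓ => ψ ℓ (toFront p)) m

/-- `𝒥^m(t, y, θ)`, the coefficient of `ε^m` in the formal inverse of `1 - χ'(x₃) ∑ ε^ℓ ψ^ℓ`. -/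
def jacCoef (χ : ℝ → ℝ) (ψ : ℕ → (Fin 4 → ℝ) → ℝ) (m : ℕ) (p : Fin 6 → ℝ) : ℝ :=
  PowerSeries.coeff m ((1 - PowerSeries.mk fun n => ∑ l ∈ Finset.HasAntidiagonal.antidiagonal n,
    chiDotCoef χ ψ l.1 p * ψ l.2 (toFront p))⁻¹ : PowerSeries ℝ)

/-! ### The source terms of the cascade -/

/-- The fast operator `ℒ_f^±(∂) = A₃^± ∂_{Y₃} + 𝒜^± ∂_θ`. -/
def fastOp (P : SheetData) (T : ℝ) (s : Side) (V : (Fin 6 → ℝ) → Fin 7 → ℝ) (p : Fin 6 → ℝ) :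
    Fin 7 → ℝ :=
  P.A s 2 *ᵥ pd (bulkDomain T s) 4 V p + P.calA s *ᵥ pd (bulkDomain T s) 5 V p

/-- The slow operator `L_s^±(∂) = A₀ ∂_t + A_α^± ∂_{y_α}`. -/
def slowOp (P : SheetData) (T : ℝ) (s : Side) (V : (Fin 6 → ℝ) → Fin 7 → ℝ) (p : Fin 6 → ℝ) :
    Fin 7 → ℝ :=
  SheetData.A0 *ᵥ pd (bulkDomain T s) 0 V p
    + ∑ α : Fin 3, P.A s α *ᵥ pd (bulkDomain T s) (yIdx α) V p

/-- The interior source term `F^{m,±}` computed from the fronts `ψ` and the bulk profiles `V`.  It is used with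
`V = U` and, for the residual component of `F^{m,±}`, with the residual components of `U`. -/
def sourceF (P : SheetData) (χ : ℝ → ℝ) (T : ℝ) (s : Side) (ψ : ℕ → (Fin 4 → ℝ) → ℝ)
    (V : ℕ → (Fin 6 → ℝ) → Fin 7 → ℝ) (m : ℕ) (p : Fin 6 → ℝ) : Fin 7 → ℝ :=
  let dV : Fin 6 → ℕ → Fin 7 → ℝ := fun i ℓ => pd (bulkDomain T s) i (V ℓ) p
  let dψ : Fin 4 → ℕ → ℝ := fun i ℓ => pd (frontDomain T) i (ψ ℓ) (toFront p)
  let chi : ℕ → ℝ := fun ℓ => chiCoef χ ψ ℓ p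
  let chiDot : ℕ → ℝ := fun ℓ => chiDotCoef χ ψ ℓ p
  -- `∂_t ψ^ℓ A₀ + ∂_{y_j} ψ^ℓ A_j^±`
  let slowM : ℕ → Matrix (Fin 7) (Fin 7) ℝ := fun ℓ =>
    dψ 0 ℓ • SheetData.A0 + ∑ j : Fin 2, dψ (yFrontIdx j) ℓ • P.A s j.castSucc;
  - slowOp P T s (V m) p
  + ∑ l ∈ Finset.HasAntidiagonal.antidiagonal (m + 2), dψ 3 l.1 • (P.calA s *ᵥ dV 4 l.2)
  + ∑ l ∈ Finset.HasAntidiagonal.antidiagonal (m + 1), slowM l.1 *ᵥ dV 4 l.2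
  + ∑ l ∈ Finset.Nat.antidiagonalTuple 3 (m + 1),
      (chi (l 0) * dψ 3 (l 1)) • (P.calA s *ᵥ dV 3 (l 2))
  + ∑ l ∈ Finset.Nat.antidiagonalTuple 3 m, chi (l 0) • (slowM (l 1) *ᵥ dV 3 (l 2))
  + ∑ l ∈ Finset.Nat.antidiagonalTuple 3 m,
      (chiDot (l 0) * ψ (l 1) (toFront p)) • (P.A s 2 *ᵥ dV 3 (l 2))
  - ∑ l ∈ Finset.HasAntidiagonal.antidiagonal m with 1 ≤ l.1 ∧ 1 ≤ l.2,
      ∑ α : Fin 3, hess α (V l.1 p) (dV (yIdx α) l.2)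
  - ∑ l ∈ Finset.HasAntidiagonal.antidiagonal (m + 1) with 1 ≤ l.1 ∧ 1 ≤ l.2,
      ∑ j : Fin 2, P.ξ j • hess j.castSucc (V l.1 p) (dV 5 l.2)
  - ∑ l ∈ Finset.HasAntidiagonal.antidiagonal (m + 1) with 1 ≤ l.1 ∧ 1 ≤ l.2, hess 2 (V l.1 p) (dV 4 l.2)
  + ∑ l ∈ Finset.Nat.antidiagonalTuple 3 (m + 2) with 1 ≤ l 1 ∧ 1 ≤ l 2,
      dψ 3 (l 0) • ∑ j : Fin 2, P.ξ j • hess j.castSucc (V (l 1) p) (dV 4 (l 2))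
  + ∑ l ∈ Finset.Nat.antidiagonalTuple 3 (m + 1) with 1 ≤ l 1 ∧ 1 ≤ l 2,
      ∑ j : Fin 2, dψ (yFrontIdx j) (l 0) • hess j.castSucc (V (l 1) p) (dV 4 (l 2))
  + ∑ l ∈ Finset.Nat.antidiagonalTuple 4 (m + 1) with 1 ≤ l 2 ∧ 1 ≤ l 3,
      (chi (l 0) * dψ 3 (l 1)) •
        ∑ j : Fin 2, P.ξ j • hess j.castSucc (V (l 2) p) (dV 3 (l 3))
  + ∑ l ∈ Finset.Nat.antidiagonalTuple 4 m with 1 ≤ l 2 ∧ 1 ≤ l 3,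
      ∑ j : Fin 2, (chi (l 0) * dψ (yFrontIdx j) (l 1)) •
        hess j.castSucc (V (l 2) p) (dV 3 (l 3))
  + ∑ l ∈ Finset.Nat.antidiagonalTuple 4 m with 1 ≤ l 2 ∧ 1 ≤ l 3,
      (chiDot (l 0) * ψ (l 1) (toFront p)) • hess 2 (V (l 2) p) (dV 3 (l 3))

/-- The source term `F₈^{m,±}` of the fast divergence constraint on the magnetic field. -/
def sourceF8 (P : SheetData) (χ : ℝ → ℝ) (T : ℝ) (s : Side) (ψ : ℕ → (Fin 4 → ℝ) → ℝ)
    (V : ℕ → (Fin 6 → ℝ) → Fin 7 → ℝ) (m : ℕ) (p : Fin 6 → ℝ) : ℝ :=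
  let dV : Fin 6 → ℕ → Fin 7 → ℝ := fun i ℓ => pd (bulkDomain T s) i (V ℓ) p
  let dψ : Fin 4 → ℕ → ℝ := fun i ℓ => pd (frontDomain T) i (ψ ℓ) (toFront p)
  let chi : ℕ → ℝ := fun ℓ => chiCoef χ ψ ℓ p
  let chiDot : ℕ → ℝ := fun ℓ => chiDotCoef χ ψ ℓ p;
  - (dV 1 m 3 + dV 2 m 4 + dV 3 m 5)
  + ∑ l ∈ Finset.HasAntidiagonal.antidiagonal (m + 2), dψ 3 l.1 * ∑ j : Fin 2, P.ξ j * dV 4 l.2 (HIdx j)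
  + ∑ l ∈ Finset.HasAntidiagonal.antidiagonal (m + 1), ∑ j : Fin 2, dψ (yFrontIdx j) l.1 * dV 4 l.2 (HIdx j)
  + ∑ l ∈ Finset.Nat.antidiagonalTuple 3 (m + 1),
      chi (l 0) * dψ 3 (l 1) * ∑ j : Fin 2, P.ξ j * dV 3 (l 2) (HIdx j)
  + ∑ l ∈ Finset.Nat.antidiagonalTuple 3 m,
      ∑ j : Fin 2, chi (l 0) * dψ (yFrontIdx j) (l 1) * dV 3 (l 2) (HIdx j)
  + ∑ l ∈ Finset.Nat.antidiagonalTuple 3 m,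
      chiDot (l 0) * ψ (l 1) (toFront p) * dV 3 (l 2) 5

/-- The boundary source term `G₁^{m,±}`. -/
def sourceG1 (P : SheetData) (T : ℝ) (s : Side) (ψ : ℕ → (Fin 4 → ℝ) → ℝ)
    (V : ℕ → (Fin 6 → ℝ) → Fin 7 → ℝ) (m : ℕ) (q : Fin 4 → ℝ) : ℝ :=
  let dψ : Fin 4 → ℕ → ℝ := fun i ℓ => pd (frontDomain T) i (ψ ℓ) q
  dψ 0 (m + 1) + ∑ j : Fin 2, P.u0 s j * dψ (yFrontIdx j) (m + 1)
  + ∑ l ∈ Finset.HasAntidiagonal.antidiagonal (m + 2) with 1 ≤ l.2,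
      dψ 3 l.1 * ∑ j : Fin 2, P.ξ j * V l.2 (toBoundary q) (uIdx j)
  + ∑ l ∈ Finset.HasAntidiagonal.antidiagonal (m + 1) with 1 ≤ l.2,
      ∑ j : Fin 2, dψ (yFrontIdx j) l.1 * V l.2 (toBoundary q) (uIdx j)

/-- The boundary source term `G₂^{m,±}`. -/
def sourceG2 (P : SheetData) (T : ℝ) (s : Side) (ψ : ℕ → (Fin 4 → ℝ) → ℝ)
    (V : ℕ → (Fin 6 → ℝ) → Fin 7 → ℝ) (m : ℕ) (q : Fin 4 → ℝ) : ℝ :=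
  let dψ : Fin 4 → ℕ → ℝ := fun i ℓ => pd (frontDomain T) i (ψ ℓ) q
  ∑ j : Fin 2, P.H0 s j * dψ (yFrontIdx j) (m + 1)
  + ∑ l ∈ Finset.HasAntidiagonal.antidiagonal (m + 2) with 1 ≤ l.2,
      dψ 3 l.1 * ∑ j : Fin 2, P.ξ j * V l.2 (toBoundary q) (HIdx j)
  + ∑ l ∈ Finset.HasAntidiagonal.antidiagonal (m + 1) with 1 ≤ l.2,
      ∑ j : Fin 2, dψ (yFrontIdx j) l.1 * V l.2 (toBoundary q) (HIdx j)

/-- `G^m = (G₁^{m,+}, G₂^{m,+}, G₁^{m,-}, G₂^{m,-}, 0)` -/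
def sourceG (P : SheetData) (T : ℝ) (W : Profiles) (m : ℕ) (q : Fin 4 → ℝ) : Fin 5 → ℝ :=
  ![sourceG1 P T .plus W.ψ (W.U .plus) m q, sourceG2 P T .plus W.ψ (W.U .plus) m q,
    sourceG1 P T .minus W.ψ (W.U .minus) m q, sourceG2 P T .minus W.ψ (W.U .minus) m q, 0]

section Components

variable (P : SheetData) (χ : ℝ → ℝ) (T : ℝ) (W : Profiles) (s : Side) (m : ℕ) (p : Fin 6 → ℝ)

/-- `F^{m,±}` -/
def Profiles.F : Fin 7 → ℝ := sourceF P χ T s W.ψ (W.U s) m p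

/-- The residual component of `F^{m,±}`. -/
def Profiles.Fres : Fin 7 → ℝ := sourceF P χ T s W.ψ (W.Ures s) m p

/-- The surface wave component of `F^{m,±}`. -/
def Profiles.Fsurf : Fin 7 → ℝ := W.F P χ T s m p - W.Fres P χ T s m p

/-- `F₈^{m,±}` -/
def Profiles.F8 : ℝ := sourceF8 P χ T s W.ψ (W.U s) m p

/-- The residual component of `F₈^{m,±}`. -/
def Profiles.F8res : ℝ := sourceF8 P χ T s W.ψ (W.Ures s) m p

/-- The surface wave component of `F₈^{m,±}`. -/
def Profiles.F8surf : ℝ := W.F8 P χ T s m p - W.F8res P χ T s m p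

end Components

/-! ### The normalization of the total pressure -/

/-- `I⁺ = (0, 1)`, `I⁻ = (-1, 0)` -/
def Side.interval : Side → Set ℝ
  | .plus => Set.Ioo 0 1
  | .minus => Set.Ioo (-1) 0

/-- `ℝ⁺ = (0, ∞)`, `ℝ⁻ = (-∞, 0)` -/
def Side.halfLine : Side → Set ℝ
  | .plus => Set.Ioi 0
  | .minus => Set.Iio 0

/-- Integral over `𝕋² × I^±`, at time `t`, of a function of `(t, y)`. -/
def slowIntegral (s : Side) (f : (Fin 6 → ℝ) → ℝ) (t : ℝ) : ℝ :=
  ∫ y₁ in (0 : ℝ)..(2 * Real.pi), ∫ y₂ in (0 : ℝ)..(2 * Real.pi), ∫ y₃ in s.interval,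
    f ![t, y₁, y₂, y₃, 0, 0]

/-- Integral over `𝕋² × ℝ^±` of `Y₃^n f(t, y', 0, Y₃)`. -/
def fastIntegral (s : Side) (n : ℕ) (f : (Fin 6 → ℝ) → ℝ) (t : ℝ) : ℝ :=
  ∫ y₁ in (0 : ℝ)..(2 * Real.pi), ∫ y₂ in (0 : ℝ)..(2 * Real.pi), ∫ Y in s.halfLine,
    Y ^ n * f ![t, y₁, y₂, 0, Y, 0]

/-- The contribution of one side to `ℐ^μ(t)`, the coefficient of `ε^μ` in the integral of the total pressure. -/
def pressureSide (χ : ℝ → ℝ) (T : ℝ) (W : Profiles) (s : Side) (μ : ℕ) (t : ℝ) : ℝ :=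
  slowIntegral s (mean 5 fun p => W.Ures s μ p 6) t
  + ∑ l ∈ Finset.HasAntidiagonal.antidiagonal (μ - 1) with 1 ≤ l.1, (1 / (l.2 ! : ℝ)) *
      fastIntegral s l.2 ((pd (bulkDomain T s) 3)^[l.2] (mean 5 fun p => W.Usurf s l.1 p 6)) t
  + ∑ l ∈ Finset.HasAntidiagonal.antidiagonal μ with 1 ≤ l.1 ∧ 2 ≤ l.2,
      slowIntegral s (mean 5 fun p => W.Ures s l.1 p 6 * jacCoef χ W.ψ l.2 p) t

/-- `ℐ^μ(t)`, for `μ ≥ 1`. -/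
def pressureNormalization (χ : ℝ → ℝ) (T : ℝ) (W : Profiles) (μ : ℕ) (t : ℝ) : ℝ :=
  pressureSide χ T W .plus μ t + pressureSide χ T W .minus μ t

/-! ### The induction hypothesis -/

/-- The integral over `ℝ^±` of `e^{∓|k| Y₃} ℒ^±(k) • \hat F^{m,±}(t, y', 0, Y₃, k)`, with `•` the Hermitian product,
antilinear in its first argument. -/
def orthogonalityIntegral (P : SheetData) (χ : ℝ → ℝ) (T : ℝ) (W : Profiles) (s : Side) (m : ℕ) (k : ℤ)
    (q : Fin 4 → ℝ) : ℂ :=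
  ∫ Y in s.halfLine, (Real.exp (-(|(k : ℝ)| * (s.sgn * Y))) : ℂ) *
    ∑ i : Fin 7, (starRingEnd ℂ) (P.calL s k i) *
      fourierMode 5 (fun p => W.F P χ T s m p i) k ![q 0, q 1, q 2, 0, Y, 0]

/-- The induction hypothesis `H(m)` on the time interval `[0,T]`, for the profiles
`(U^{1,±}, ψ²), …, (U^{m-1,±}, ψ^m), (U^{m,±}, ψ_♯^{m+1})`.  In the family `W` the front of index `m+1` is the purely
oscillating front `ψ_♯^{m+1}`; profiles of higher index play no role. -/
structure InductionHypothesis (P : SheetData) (χ : ℝ → ℝ) (T : ℝ) (m : ℕ) (W : Profiles) : Prop where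
  /-- `U^{0,±}` is the reference state. -/
  ref_res : ∀ s p, W.Ures s 0 p = P.refState s
  ref_surf : ∀ s p, W.Usurf s 0 p = 0
  /-- `ψ⁰ = ψ¹ = 0` -/
  front_zero : ∀ q, W.ψ 0 q = 0
  front_one : ∀ q, W.ψ 1 q = 0
  /-- regularity -/
  mem_res : ∀ s, ∀ μ, 1 ≤ μ → μ ≤ m → ResidualSpace T s (W.Ures s μ)
  mem_surf : ∀ s, ∀ μ, 1 ≤ μ → μ ≤ m → SurfaceSpace T s (W.Usurf s μ)
  mem_front : ∀ μ, 2 ≤ μ → μ ≤ m + 1 → FrontHInf T (W.ψ μ)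
  osc_front : ∀ q ∈ frontDomain T, mean 3 (W.ψ (m + 1)) q = 0
  /-- the fast problems already solved -/
  fast : ∀ μ, 1 ≤ μ → μ ≤ m → ∀ s, ∀ p ∈ bulkInterior T s,
    fastOp P T s (W.U s μ) p = W.F P χ T s (μ - 1) p
  fast_div : ∀ μ, 1 ≤ μ → μ ≤ m → ∀ s, ∀ p ∈ bulkInterior T s,
    pd (bulkDomain T s) 4 (W.U s μ) p 5
      + ∑ j : Fin 2, P.ξ j * pd (bulkDomain T s) 5 (W.U s μ) p (HIdx j) = W.F8 P χ T s (μ - 1) p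
  jump : ∀ μ, 1 ≤ μ → μ ≤ m → ∀ q ∈ frontDomain T,
    Bmat .plus *ᵥ W.U .plus μ (toBoundary q) + Bmat .minus *ᵥ W.U .minus μ (toBoundary q)
      + pd (frontDomain T) 3 (W.ψ (μ + 1)) q • P.bVec = sourceG P T W (μ - 1) q
  /-- the conditions on the fixed boundaries `y₃ = ±1` -/
  top_bottom : ∀ μ, 1 ≤ μ → μ ≤ m → ∀ s, ∀ p ∈ bulkDomain T s, p 3 = s.sgn →
    W.Ures s μ p 2 = 0 ∧ W.Ures s μ p 5 = 0
  /-- the normalization of the total pressure -/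
  pressure : ∀ μ, 1 ≤ μ → μ ≤ m → ∀ t ∈ Set.Icc 0 T, pressureNormalization χ T W μ t = 0
  /-- the slow means of the next source terms -/
  slow_mean : ∀ s, ∀ p ∈ bulkInterior T s,
    (∀ i, mean 5 (fun p => W.Fres P χ T s m p i) p = 0) ∧ mean 5 (W.F8res P χ T s m) p = 0
  /-- the fast means of the next source terms -/
  fast_mean_u : ∀ s, ∀ p ∈ bulkInterior T s, ∀ j : Fin 2,
    P.u0 s j * mean 5 (fun p => W.Fsurf P χ T s m p 6) p - P.H0 s j * mean 5 (W.F8surf P χ T s m) p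
      = mean 5 (fun p => W.Fsurf P χ T s m p (uIdx j)) p
  fast_mean_H : ∀ s, ∀ p ∈ bulkInterior T s, ∀ j : Fin 2,
    P.H0 s j * mean 5 (fun p => W.Fsurf P χ T s m p 6) p - P.u0 s j * mean 5 (W.F8surf P χ T s m) p
      = mean 5 (fun p => W.Fsurf P χ T s m p (HIdx j)) p
  /-- the orthogonality condition for the nonzero Fourier modes -/
  orthogonality : ∀ k : ℤ, k ≠ 0 → ∀ q ∈ frontDomain T,
    orthogonalityIntegral P χ T W .plus m k q - orthogonalityIntegral P χ T W .minus m k q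
      + P.ell1 .plus * fourierMode 3 (sourceG1 P T .plus W.ψ (W.U .plus) m) k q
      + P.ell2 .plus * fourierMode 3 (sourceG2 P T .plus W.ψ (W.U .plus) m) k q
      + P.ell1 .minus * fourierMode 3 (sourceG1 P T .minus W.ψ (W.U .minus) m) k q
      + P.ell2 .minus * fourierMode 3 (sourceG2 P T .minus W.ψ (W.U .minus) m) k q = 0

/-- The profiles in which the front of index `n` is replaced by `Ψ`. -/
def Profiles.withFront (W : Profiles) (n : ℕ) (Ψ : (Fin 4 → ℝ) → ℝ) : Profiles where
  Ures := W.Ures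
  Usurf := W.Usurf
  ψ := Function.update W.ψ n Ψ

end

/-! The sources are coefficients of formal power series in `ε`. Where the cut-off equals `1`, let
`R_β`, `D_u`, `D_H` be the residuals, multiplied by `ε²`, of the equation of `H_β` and of the two
divergence constraints in straightened two-scale variables. Let `B_u`, `B_H` be the residuals,
multiplied by `ε`, of the kinematic condition and of the tangency of `H`. Solving the cascade up to
order `m` means that all of these are `O(ε^{m+2})`, in the interior or on the front respectively
(`sourceF_magIdx`, `sourceF_six`, `sourceF8_eq`, `coeff_bdryResidual_vel`,
`coeff_bdryResidual_mag`). Once the profiles `U^{m+1}` and `ψ^{m+2}` are set to zero, the next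
coefficients are, up to sign, `F₆^m`, `G₁^m` and `G₂^m`.

Two exact identities link them. Expanding `curl (u × H)` gives (`magResidual_eq_transport`) `R_β = ε
𝒯_β + H_β D_u - u_β D_H + B_u ∂_N H_β - B_H ∂_N u_β`, where `𝒯_β` is the tangential part of `(∂_t +
u·∇) H_β - (H·∇) u_β` and `∂_N = ε ∂_{y₃} + ∂_{Y₃}`. On the front, `ε 𝒯₃` equals `(∂_t + u_j ∂_j)
B_H - H_j ∂_j B_u`, with two-scale tangential derivatives, plus the slopes of the front times `𝒯₁`,
`𝒯₂`; the second derivatives of the front cancel by symmetry (`transport_normal_eq`).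

For `β = 3` every remaining term carries one extra power of `ε`: `u₃`, `H₃` and `∂_N U` are `O(ε)`,
the slopes are `O(ε²)`, and `ε 𝒯₁`, `ε 𝒯₂` are `O(ε^{m+2})` by the first identity
(`magResidual_normal_congr`). At order `ε^{m+2}` the derivatives of `B_H` and `B_u` reduce to `(τ +
ξ_j u_j⁰) ∂_θ = c ∂_θ` and `ξ_j H_j⁰ ∂_θ = b ∂_θ`, which is the claim.

The mean of `ψ^{m+1}` plays no role: the equations already solved contain this front only through
its `θ`-derivative (`pd_oscillating`). -/

noncomputable section

open scoped PowerSeries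

/-! ### Sums over compositions of an integer. -/

/-- Sums over compositions of length `k + 1`, according to the first part. -/
theorem Finset.Nat.sum_antidiagonalTuple_succ {M : Type*} [AddCommMonoid M] (k n : ℕ)
    (f : (Fin (k + 1) → ℕ) → M) :
    ∑ l ∈ Finset.Nat.antidiagonalTuple (k + 1) n, f l
      = ∑ r ∈ Finset.HasAntidiagonal.antidiagonal n, ∑ l ∈ Finset.Nat.antidiagonalTuple k r.2, f (Fin.cons r.1 l) := by
  rw [Finset.sum_sigma']
  refine Finset.sum_bij' (fun l _ => ⟨(l 0, ∑ i : Fin k, l i.succ), Fin.tail l⟩)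
    (fun r _ => Fin.cons r.1.1 r.2) ?_ ?_ ?_ ?_ ?_
  · intro l hl
    simp only [Finset.Nat.mem_antidiagonalTuple, Fin.sum_univ_succ] at hl
    simp [Finset.Nat.mem_antidiagonalTuple, hl, Fin.tail]
  · rintro ⟨⟨a, b⟩, l⟩ hl
    simp only [Finset.mem_sigma, Finset.HasAntidiagonal.mem_antidiagonal, Finset.Nat.mem_antidiagonalTuple] at hl
    simp [Finset.Nat.mem_antidiagonalTuple, Fin.sum_univ_succ, hl.1, hl.2]
  · intro l _
    exact Fin.cons_self_tail l
  · rintro ⟨⟨a, b⟩, l⟩ hl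
    simp only [Finset.mem_sigma, Finset.HasAntidiagonal.mem_antidiagonal, Finset.Nat.mem_antidiagonalTuple] at hl
    obtain ⟨-, rfl⟩ := hl
    simp
  · intro l _
    simp

theorem Finset.Nat.sum_antidiagonalTuple_two {M : Type*} [AddCommMonoid M] (n : ℕ)
    (f : (Fin 2 → ℕ) → M) :
    ∑ l ∈ Finset.Nat.antidiagonalTuple 2 n, f l = ∑ r ∈ Finset.HasAntidiagonal.antidiagonal n, f ![r.1, r.2] := by
  rw [Finset.Nat.sum_antidiagonalTuple_succ]
  refine Finset.sum_congr rfl fun r _ => ?_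
  simp [Finset.Nat.antidiagonalTuple_one]

theorem Finset.Nat.sum_antidiagonalTuple_three {M : Type*} [AddCommMonoid M] (n : ℕ)
    (f : (Fin 3 → ℕ) → M) :
    ∑ l ∈ Finset.Nat.antidiagonalTuple 3 n, f l
      = ∑ r ∈ Finset.HasAntidiagonal.antidiagonal n, ∑ r' ∈ Finset.HasAntidiagonal.antidiagonal r.2, f ![r.1, r'.1, r'.2] := by
  rw [Finset.Nat.sum_antidiagonalTuple_succ]
  refine Finset.sum_congr rfl fun r _ => ?_
  rw [Finset.Nat.sum_antidiagonalTuple_two]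
  rfl

/-- A sum over compositions weighted by `δ_{l₀,0}`. -/
theorem Finset.Nat.sum_antidiagonalTuple_head_zero {M : Type*} [AddCommMonoid M] (k n : ℕ)
    (f : (Fin (k + 1) → ℕ) → M) (h : ∀ l, l 0 ≠ 0 → f l = 0) :
    ∑ l ∈ Finset.Nat.antidiagonalTuple (k + 1) n, f l
      = ∑ l ∈ Finset.Nat.antidiagonalTuple k n, f (Fin.cons 0 l) := by
  rw [Finset.Nat.sum_antidiagonalTuple_succ, Finset.sum_eq_single (0, n)]
  · rintro ⟨a, b⟩ hab hne
    refine Finset.sum_eq_zero fun l _ => h _ ?_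
    simp only [Finset.HasAntidiagonal.mem_antidiagonal] at hab
    simp only [Fin.cons_zero]
    rintro rfl
    exact hne (by simpa using hab)
  · simp

/-! ### The coefficients of the cut-off near the front. -/

section Cutoff

variable {χ : ℝ → ℝ}

/-- A partition of `m` has at most `m` parts, and at least one if `m ≠ 0`, so no other derivative of
`g` enters. Exempting order `0` when `m ≠ 0` lets the lemma apply to `χ`, which equals `1` near the
front, as well as to `χ'`. -/
theorem faaDiBruno_eq_zero {g : ℝ → ℝ} {y : ℝ} {m : ℕ}
    (hg : ∀ k, k ≤ m → (m ≠ 0 → k ≠ 0) → iteratedDeriv k g y = 0) (X : ℕ → ℝ) :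
    faaDiBruno g y X m = 0 := by
  refine Finset.sum_eq_zero fun μ _ => ?_
  rw [hg, zero_mul]
  · calc Multiset.card μ.parts = (μ.parts.map fun _ => 1).sum := by simp
      _ ≤ (μ.parts.map id).sum :=
        Multiset.sum_map_le_sum_map _ _ fun i hi => μ.parts_pos hi
      _ = m := by simp [μ.parts_sum]
  · intro hm h
    apply hm
    rw [Multiset.card_eq_zero] at h
    rw [← μ.parts_sum, h, Multiset.sum_zero]

theorem faaDiBruno_zero (g : ℝ → ℝ) (y : ℝ) (X : ℕ → ℝ) : faaDiBruno g y X 0 = g y := by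
  simp [faaDiBruno, Finset.univ_unique]

theorem IsCutoff.iteratedDeriv_eq_zero (hχ : IsCutoff χ) {y : ℝ} (hy : |y| < 1 / 3) (k : ℕ) :
    iteratedDeriv (k + 1) χ y = 0 := by
  have h : χ =ᶠ[nhds y] fun _ => 1 := by
    have : {x : ℝ | |x| < 1 / 3} ∈ nhds y :=
      (isOpen_lt continuous_abs continuous_const).mem_nhds hy
    filter_upwards [this] with x hx
    exact hχ.eq_one x (by rw [Set.mem_Icc]; exact abs_le.mp (le_of_lt hx))
  rw [h.iteratedDeriv_eq]
  simp [iteratedDeriv_const]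

theorem IsCutoff.chiCoef_eq (hχ : IsCutoff χ) (ψ : ℕ → (Fin 4 → ℝ) → ℝ) {p : Fin 6 → ℝ}
    (hp : |p 3| < 1 / 3) (m : ℕ) : chiCoef χ ψ m p = if m = 0 then 1 else 0 := by
  unfold chiCoef
  split_ifs with hm
  · subst hm
    rw [faaDiBruno_zero]
    exact hχ.eq_one _ (by rw [Set.mem_Icc]; exact abs_le.mp (le_of_lt hp))
  · refine faaDiBruno_eq_zero (fun k _ hk => ?_) _
    obtain ⟨j, rfl⟩ := Nat.exists_eq_succ_of_ne_zero (hk hm)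
    exact hχ.iteratedDeriv_eq_zero hp j

theorem IsCutoff.chiDotCoef_eq (hχ : IsCutoff χ) (ψ : ℕ → (Fin 4 → ℝ) → ℝ) {p : Fin 6 → ℝ}
    (hp : |p 3| < 1 / 3) (m : ℕ) : chiDotCoef χ ψ m p = 0 := by
  refine faaDiBruno_eq_zero (fun k _ _ => ?_) _
  rw [← iteratedDeriv_succ']
  exact hχ.iteratedDeriv_eq_zero hp k

end Cutoff

/-! ### The interior source terms where the cut-off is `1`. -/

/-- The source term `F^{n,±}` where the cut-off is `1` depends only on `U^ℓ`, `ℓ ≤ n`, and on `ψ^ℓ`,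
`ℓ ≤ n + 1`. -/
theorem sourceF_congr {P : SheetData} {χ : ℝ → ℝ} (hχ : IsCutoff χ) {T : ℝ} {s : Side}
    {ψ ψ' : ℕ → (Fin 4 → ℝ) → ℝ} {V V' : ℕ → (Fin 6 → ℝ) → Fin 7 → ℝ} {n : ℕ} {p : Fin 6 → ℝ}
    (hp : |p 3| < 1 / 3) (hV : ∀ ℓ ≤ n, V ℓ = V' ℓ) (hψ : ∀ ℓ ≤ n + 1, ψ ℓ = ψ' ℓ)
    (h0 : ψ 0 = 0) (h1 : ψ 1 = 0) (hc : ∀ i, pd (bulkDomain T s) i (V 0) p = 0) :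
    sourceF P χ T s ψ V n p = sourceF P χ T s ψ' V' n p := by
  have hdV : ∀ ℓ ≤ n, ∀ i, pd (bulkDomain T s) i (V ℓ) p = pd (bulkDomain T s) i (V' ℓ) p :=
    fun ℓ h i => by rw [hV ℓ h]
  have hdψ : ∀ ℓ ≤ n + 1, ∀ i, pd (frontDomain T) i (ψ ℓ) (toFront p)
      = pd (frontDomain T) i (ψ' ℓ) (toFront p) := fun ℓ h i => by rw [hψ ℓ h]
  have hc' : ∀ i, pd (bulkDomain T s) i (V' 0) p = 0 := fun i => by rw [← hV 0 (Nat.zero_le _)]; exact hc i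
  have hz : ∀ i, pd (frontDomain T) i (0 : (Fin 4 → ℝ) → ℝ) (toFront p) = 0 := by
    intro i; simp [pd]
  have z0 : ∀ i, pd (frontDomain T) i (ψ 0) (toFront p) = 0 := by rw [h0]; exact hz
  have z1 : ∀ i, pd (frontDomain T) i (ψ 1) (toFront p) = 0 := by rw [h1]; exact hz
  have z0' : ∀ i, pd (frontDomain T) i (ψ' 0) (toFront p) = 0 := by
    rw [← hψ 0 (Nat.zero_le _), h0]; exact hz
  have z1' : ∀ i, pd (frontDomain T) i (ψ' 1) (toFront p) = 0 := by
    rw [← hψ 1 (by omega), h1]; exact hz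
  unfold sourceF slowOp
  simp only [hχ.chiCoef_eq _ hp, hχ.chiDotCoef_eq _ hp]
  simp only [hV n le_rfl]
  congr 1; congr 1; congr 1; congr 1; congr 1; congr 1; congr 1; congr 1; congr 1; congr 1
  congr 1; congr 1; congr 1
  all_goals
    refine Finset.sum_congr rfl fun l hl => ?_
    simp only [Finset.mem_filter, Finset.HasAntidiagonal.mem_antidiagonal,
      Finset.Nat.mem_antidiagonalTuple, Fin.sum_univ_three, Fin.sum_univ_four] at hl
  -- The formula does mention `ψ^{n+2}`, `U^{n+1}` and `U^{n+2}`, but the first only multiplies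
  -- derivatives of the constant `U⁰`, and the others are only multiplied by derivatives of `ψ⁰` or
  -- `ψ¹`, which vanish.
  · rcases (by omega : (l.1 ≤ n + 1 ∧ l.2 ≤ n) ∨ l.1 = 0 ∨ l.1 = 1 ∨ l.2 = 0) with h | h | h | h
    · rw [hdV _ h.2, hdψ _ h.1]
    all_goals simp [h, hc, hc', z0, z0', z1, z1']
  · rcases (by omega : (l.1 ≤ n + 1 ∧ l.2 ≤ n) ∨ l.1 = 0 ∨ l.1 = 1 ∨ l.2 = 0) with h | h | h | h
    · simp only [hdV _ h.2, hdψ _ h.1]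
    all_goals simp [h, hc, hc', z0, z0', z1, z1']
  · rcases (by omega : (l 1 ≤ n + 1 ∧ l 2 ≤ n) ∨ l 1 = 0 ∨ l 1 = 1 ∨ l 2 = 0) with h | h | h | h
    · simp only [hdV _ h.2, hdψ _ h.1]
    all_goals simp [h, hc, hc', z0, z0', z1, z1']
  · rw [hdV _ (by omega)]
    simp only [hdψ (l 1) (by omega)]
  · simp
  · simp only [hdV l.2 (by omega), hV l.1 (by omega)]
  · simp only [hdV l.2 (by omega), hV l.1 (by omega)]
  · simp only [hdV l.2 (by omega), hV l.1 (by omega)]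
  · rcases (by omega : (l 0 ≤ n + 1 ∧ l 1 ≤ n ∧ l 2 ≤ n) ∨ l 0 = 0 ∨ l 0 = 1) with h | h | h
    · simp only [hdV _ h.2.2, hdψ _ h.1, hV _ h.2.1]
    all_goals simp [h, z0, z0', z1, z1']
  · simp only [hdV (l 2) (by omega), hdψ (l 0) (by omega), hV (l 1) (by omega)]
  · simp only [hdV (l 3) (by omega), hdψ (l 1) (by omega), hV (l 2) (by omega)]
  · simp only [hdV (l 3) (by omega), hdψ (l 1) (by omega), hV (l 2) (by omega)]
  · simp

/-- Weighted sums over triples whose first entry is forced to vanish. -/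
theorem Finset.Nat.sum_antidiagonalTuple_three_head_zero {M : Type*} [AddCommMonoid M] (n : ℕ)
    (f : (Fin 3 → ℕ) → M) (h : ∀ l, l 0 ≠ 0 → f l = 0) :
    ∑ l ∈ Finset.Nat.antidiagonalTuple 3 n, f l
      = ∑ r ∈ Finset.HasAntidiagonal.antidiagonal n, f ![0, r.1, r.2] := by
  rw [Finset.Nat.sum_antidiagonalTuple_head_zero 2 n f h, Finset.Nat.sum_antidiagonalTuple_two]
  rfl

/-- The source term `F^{m,±}` where the cut-off is `1`. -/
theorem sourceF_eq_of_near (P : SheetData) {χ : ℝ → ℝ} (hχ : IsCutoff χ) (T : ℝ) (s : Side)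
    (ψ : ℕ → (Fin 4 → ℝ) → ℝ) (V : ℕ → (Fin 6 → ℝ) → Fin 7 → ℝ) (m : ℕ) {p : Fin 6 → ℝ}
    (hp : |p 3| < 1 / 3) :
    sourceF P χ T s ψ V m p =
      let dV : Fin 6 → ℕ → Fin 7 → ℝ := fun i ℓ => pd (bulkDomain T s) i (V ℓ) p
      let dψ : Fin 4 → ℕ → ℝ := fun i ℓ => pd (frontDomain T) i (ψ ℓ) (toFront p)
      let slowM : ℕ → Matrix (Fin 7) (Fin 7) ℝ := fun ℓ =>
        dψ 0 ℓ • SheetData.A0 + ∑ j : Fin 2, dψ (yFrontIdx j) ℓ • P.A s j.castSucc;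
      - slowOp P T s (V m) p
      + ∑ l ∈ Finset.HasAntidiagonal.antidiagonal (m + 2), dψ 3 l.1 • (P.calA s *ᵥ dV 4 l.2)
      + ∑ l ∈ Finset.HasAntidiagonal.antidiagonal (m + 1), slowM l.1 *ᵥ dV 4 l.2
      + ∑ l ∈ Finset.HasAntidiagonal.antidiagonal (m + 1), dψ 3 l.1 • (P.calA s *ᵥ dV 3 l.2)
      + ∑ l ∈ Finset.HasAntidiagonal.antidiagonal m, slowM l.1 *ᵥ dV 3 l.2
      - ∑ l ∈ Finset.HasAntidiagonal.antidiagonal m with 1 ≤ l.1 ∧ 1 ≤ l.2,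
          ∑ α : Fin 3, hess α (V l.1 p) (dV (yIdx α) l.2)
      - ∑ l ∈ Finset.HasAntidiagonal.antidiagonal (m + 1) with 1 ≤ l.1 ∧ 1 ≤ l.2,
          ∑ j : Fin 2, P.ξ j • hess j.castSucc (V l.1 p) (dV 5 l.2)
      - ∑ l ∈ Finset.HasAntidiagonal.antidiagonal (m + 1) with 1 ≤ l.1 ∧ 1 ≤ l.2,
          hess 2 (V l.1 p) (dV 4 l.2)
      + ∑ l ∈ Finset.Nat.antidiagonalTuple 3 (m + 2) with 1 ≤ l 1 ∧ 1 ≤ l 2,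
          dψ 3 (l 0) • ∑ j : Fin 2, P.ξ j • hess j.castSucc (V (l 1) p) (dV 4 (l 2))
      + ∑ l ∈ Finset.Nat.antidiagonalTuple 3 (m + 1) with 1 ≤ l 1 ∧ 1 ≤ l 2,
          ∑ j : Fin 2, dψ (yFrontIdx j) (l 0) • hess j.castSucc (V (l 1) p) (dV 4 (l 2))
      + ∑ l ∈ Finset.Nat.antidiagonalTuple 3 (m + 1) with 1 ≤ l 1 ∧ 1 ≤ l 2,
          dψ 3 (l 0) • ∑ j : Fin 2, P.ξ j • hess j.castSucc (V (l 1) p) (dV 3 (l 2))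
      + ∑ l ∈ Finset.Nat.antidiagonalTuple 3 m with 1 ≤ l 1 ∧ 1 ≤ l 2,
          ∑ j : Fin 2, dψ (yFrontIdx j) (l 0) • hess j.castSucc (V (l 1) p) (dV 3 (l 2)) := by
  unfold sourceF
  simp only [hχ.chiCoef_eq _ hp, hχ.chiDotCoef_eq _ hp, Finset.sum_filter]
  -- Since `χ^{[ℓ]} = δ_{ℓ,0}`, each sum containing it loses its first index.
  have e3 : ∀ (n : ℕ) (f : (Fin 3 → ℕ) → Fin 7 → ℝ) (g : ℕ × ℕ → Fin 7 → ℝ),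
      (∀ l, l 0 ≠ 0 → f l = 0) → (∀ r, f ![0, r.1, r.2] = g r) →
      ∑ l ∈ Finset.Nat.antidiagonalTuple 3 n, f l
        = ∑ r ∈ Finset.HasAntidiagonal.antidiagonal n, g r := fun n f g hf hg => by
    rw [Finset.Nat.sum_antidiagonalTuple_three_head_zero n f hf]
    exact Finset.sum_congr rfl fun r _ => hg r
  have e4 : ∀ (n : ℕ) (f : (Fin 4 → ℕ) → Fin 7 → ℝ) (g : (Fin 3 → ℕ) → Fin 7 → ℝ),
      (∀ l, l 0 ≠ 0 → f l = 0) → (∀ l, f (Fin.cons 0 l) = g l) →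
      ∑ l ∈ Finset.Nat.antidiagonalTuple 4 n, f l
        = ∑ l ∈ Finset.Nat.antidiagonalTuple 3 n, g l := fun n f g hf hg => by
    rw [Finset.Nat.sum_antidiagonalTuple_head_zero 3 n f hf]
    exact Finset.sum_congr rfl fun r _ => hg r
  have c1 : ∀ l : Fin 3 → ℕ, (Fin.cons 0 l : Fin 4 → ℕ) 1 = l 0 := fun l => rfl
  have c2 : ∀ l : Fin 3 → ℕ, (Fin.cons 0 l : Fin 4 → ℕ) 2 = l 1 := fun l => rfl
  have c3 : ∀ l : Fin 3 → ℕ, (Fin.cons 0 l : Fin 4 → ℕ) 3 = l 2 := fun l => rfl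
  simp only [zero_mul, zero_smul, Finset.sum_const_zero, ite_self, add_zero]
  refine congrArg₂ _ (congrArg₂ _ (congrArg₂ _ (congrArg₂ _ (congrArg₂ _ (congrArg₂ _
    (congrArg₂ _ (congrArg₂ _ (congrArg₂ _ rfl ?_) ?_) rfl) rfl) rfl) rfl) rfl) ?_) ?_
  · exact e3 _ _ _ (fun l hl => by simp [hl]) fun r => by simp
  · exact e3 _ _ _ (fun l hl => by simp [hl]) fun r => by simp
  · exact e4 _ _ _ (fun l hl => by simp [hl]) fun l => by simp [c1, c2, c3]
  · exact e4 _ _ _ (fun l hl => by simp [hl]) fun l => by simp [c1, c2, c3]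

/-! ### The bilinear form of the induction equation and the interior residual series. -/

/-- The index of `u_α` (`α = 1, 2, 3`) in a vector of length `7`. -/
def velIdx (α : Fin 3) : Fin 7 := ![0, 1, 2] α

/-- The index of `H_α` (`α = 1, 2, 3`) in a vector of length `7`. -/
def magIdx (α : Fin 3) : Fin 7 := ![3, 4, 5] α

/-- The polarization of `u_α H_β - H_α u_β`. -/
def inductionForm {R : Type*} [CommRing R] (α β : Fin 3) (v w : Fin 7 → R) : R :=
  v (velIdx α) * w (magIdx β) + v (magIdx β) * w (velIdx α)
    - v (magIdx α) * w (velIdx β) - v (velIdx β) * w (magIdx α)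

theorem hess_magIdx (α β : Fin 3) (v w : Fin 7 → ℝ) :
    hess α v w (magIdx β) = inductionForm α β v w := by
  fin_cases α <;> fin_cases β <;> simp [hess, inductionForm, velIdx, magIdx] <;> ring

/-- The magnetic rows of the fluxes are homogeneous quadratic, so their differential at `U⁰` is the
Hessian with `U⁰` in one slot. Linear and quadratic terms of the cascade thus merge into a single
Cauchy product that includes the index `0`. -/
theorem A_mulVec_magIdx (P : SheetData) (s : Side) (α β : Fin 3) (w : Fin 7 → ℝ) :
    (P.A s α *ᵥ w) (magIdx β) = inductionForm α β (P.refState s) w := by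
  fin_cases α <;> fin_cases β <;>
    simp [SheetData.A, inductionForm, velIdx, magIdx, SheetData.refState, Matrix.mulVec, dotProduct,
      Fin.sum_univ_succ] <;> ring

theorem A0_mulVec_magIdx (β : Fin 3) (w : Fin 7 → ℝ) :
    (SheetData.A0 *ᵥ w) (magIdx β) = w (magIdx β) := by
  fin_cases β <;> simp [SheetData.A0, magIdx, Matrix.mulVec_diagonal]

theorem A_mulVec_six (P : SheetData) (s : Side) (α : Fin 3) (w : Fin 7 → ℝ) :
    (P.A s α *ᵥ w) 6 = w (velIdx α) := by
  fin_cases α <;>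
    simp [SheetData.A, velIdx, Matrix.mulVec, dotProduct, Fin.sum_univ_succ]

theorem A0_mulVec_six (w : Fin 7 → ℝ) : (SheetData.A0 *ᵥ w) 6 = 0 := by
  simp [SheetData.A0, Matrix.mulVec_diagonal]

theorem hess_six (α : Fin 3) (v w : Fin 7 → ℝ) : hess α v w 6 = 0 := by
  fin_cases α <;> simp [hess]

/-- The formal series `∑ ε^n v_n` of vectors, componentwise. -/
def vecSeries (v : ℕ → Fin 7 → ℝ) (k : Fin 7) : ℝ⟦X⟧ := PowerSeries.mk fun n => v n k

theorem coeff_inductionForm (α β : Fin 3) (v w : ℕ → Fin 7 → ℝ) (n : ℕ) :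
    PowerSeries.coeff n (inductionForm α β (vecSeries v) (vecSeries w))
      = ∑ l ∈ Finset.HasAntidiagonal.antidiagonal n, inductionForm α β (v l.1) (w l.2) := by
  simp [inductionForm, vecSeries, PowerSeries.coeff_mul, Finset.sum_add_distrib,
    Finset.sum_sub_distrib]

theorem inductionForm_zero_right (α β : Fin 3) (v : Fin 7 → ℝ) : inductionForm α β v 0 = 0 := by
  simp [inductionForm]

/-- The pair `(0, n)` gives the linear term `A_α w_n`. The other pairs with a zero index have second
index `0` and vanish with `w 0`, which in the application is a derivative of a constant state. What
is left carries the index restrictions of the quadratic sums in `F^m`. -/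
theorem coeff_inductionForm_of_zero (α β : Fin 3) {v w : ℕ → Fin 7 → ℝ} (hw : w 0 = 0) (n : ℕ) :
    PowerSeries.coeff n (inductionForm α β (vecSeries v) (vecSeries w))
      = inductionForm α β (v 0) (w n)
        + ∑ l ∈ Finset.HasAntidiagonal.antidiagonal n with 1 ≤ l.1 ∧ 1 ≤ l.2,
            inductionForm α β (v l.1) (w l.2) := by
  rw [coeff_inductionForm, ← Finset.add_sum_erase _ _ (a := (0, n)) (by simp)]
  congr 1
  symm
  apply Finset.sum_subset_zero_on_sdiff
  · intro l hl
    simp only [Finset.mem_filter, Finset.mem_erase, ne_eq, Prod.ext_iff] at hl ⊢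
    exact ⟨fun h => by omega, hl.1⟩
  · intro l hl
    have : l.2 = 0 := by
      simp only [Finset.mem_filter, Finset.mem_erase, ne_eq, Prod.ext_iff, Finset.mem_sdiff,
        Finset.HasAntidiagonal.mem_antidiagonal, not_and] at hl
      omega
    rw [this, hw, inductionForm_zero_right]
  · intros; rfl

theorem coeff_mk_mul_inductionForm (α β : Fin 3) (f : ℕ → ℝ) {v w : ℕ → Fin 7 → ℝ} (hw : w 0 = 0)
    (n : ℕ) :
    PowerSeries.coeff n (PowerSeries.mk f * inductionForm α β (vecSeries v) (vecSeries w))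
      = ∑ l ∈ Finset.HasAntidiagonal.antidiagonal n, f l.1 * inductionForm α β (v 0) (w l.2)
        + ∑ l ∈ Finset.Nat.antidiagonalTuple 3 n with 1 ≤ l 1 ∧ 1 ≤ l 2,
            f (l 0) * inductionForm α β (v (l 1)) (w (l 2)) := by
  rw [PowerSeries.coeff_mul, Finset.sum_filter, Finset.Nat.sum_antidiagonalTuple_three,
    ← Finset.sum_add_distrib]
  refine Finset.sum_congr rfl fun l _ => ?_
  rw [PowerSeries.coeff_mk, coeff_inductionForm_of_zero α β hw, mul_add, Finset.sum_filter,
    Finset.mul_sum]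
  congr 1
  refine Finset.sum_congr rfl fun r _ => ?_
  rw [mul_ite, mul_zero]
  exact if_congr (by simp) rfl rfl

/-- The residual of the evolution equation of `H_β` multiplied by `ε²`, as a formal series in `ε` where the
cut-off is `1`, computed from the series of the bulk profiles `v`, of their derivatives `dv` and of the
derivatives `d` of the front. -/
def magResidual (P : SheetData) (β : Fin 3) (v : Fin 7 → ℝ⟦X⟧) (dv : Fin 6 → Fin 7 → ℝ⟦X⟧)
    (d : Fin 4 → ℝ⟦X⟧) : ℝ⟦X⟧ :=
  PowerSeries.X ^ 2 * (dv 0 (magIdx β) + ∑ α : Fin 3, inductionForm α β v (dv (yIdx α))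
      - (d 0 * dv 3 (magIdx β)
        + ∑ j : Fin 2, d (yFrontIdx j) * inductionForm j.castSucc β v (dv 3)))
  + PowerSeries.X ^ 1 * (PowerSeries.C P.τ * dv 5 (magIdx β)
      + ∑ j : Fin 2, PowerSeries.C (P.ξ j) * inductionForm j.castSucc β v (dv 5)
      + inductionForm 2 β v (dv 4)
      - (d 0 * dv 4 (magIdx β)
        + ∑ j : Fin 2, d (yFrontIdx j) * inductionForm j.castSucc β v (dv 4))
      - (PowerSeries.C P.τ * (d 3 * dv 3 (magIdx β))
        + ∑ j : Fin 2, PowerSeries.C (P.ξ j) * (d 3 * inductionForm j.castSucc β v (dv 3))))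
  - (PowerSeries.C P.τ * (d 3 * dv 4 (magIdx β))
      + ∑ j : Fin 2, PowerSeries.C (P.ξ j) * (d 3 * inductionForm j.castSucc β v (dv 4)))

/-- The residual of the constraint that the field with components `w`, at the indices `idx`, is free of
divergence, multiplied by `ε²`, as a formal series in `ε` where the cut-off is `1`. -/
def divResidual (P : SheetData) (idx : Fin 3 → Fin 7) (dv : Fin 6 → Fin 7 → ℝ⟦X⟧)
    (d : Fin 4 → ℝ⟦X⟧) : ℝ⟦X⟧ :=
  PowerSeries.X ^ 2 * (∑ α : Fin 3, dv (yIdx α) (idx α)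
      - ∑ j : Fin 2, d (yFrontIdx j) * dv 3 (idx j.castSucc))
  + PowerSeries.X ^ 1 * (∑ j : Fin 2, PowerSeries.C (P.ξ j) * dv 5 (idx j.castSucc)
      + dv 4 (idx 2)
      - ∑ j : Fin 2, d (yFrontIdx j) * dv 4 (idx j.castSucc)
      - ∑ j : Fin 2, PowerSeries.C (P.ξ j) * (d 3 * dv 3 (idx j.castSucc)))
  - ∑ j : Fin 2, PowerSeries.C (P.ξ j) * (d 3 * dv 4 (idx j.castSucc))

/-- The powers of `X` record the shifts `m`, `m + 1`, `m + 2` of the total index in the definition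
of the source terms. -/
theorem coeff_residual_form (n : ℕ) (f g h : ℝ⟦X⟧) :
    PowerSeries.coeff (n + 2) (PowerSeries.X ^ 2 * f + PowerSeries.X ^ 1 * g - h)
      = PowerSeries.coeff n f + PowerSeries.coeff (n + 1) g - PowerSeries.coeff (n + 2) h := by
  rw [map_sub, map_add, PowerSeries.coeff_X_pow_mul, show n + 2 = (n + 1) + 1 from rfl,
    PowerSeries.coeff_X_pow_mul]

/-! ### The interior source terms as coefficients of the residual series. -/

/-- The series of the bulk profiles at a point. -/
def profileSeries (V : ℕ → (Fin 6 → ℝ) → Fin 7 → ℝ) (p : Fin 6 → ℝ) : Fin 7 → ℝ⟦X⟧ :=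
  vecSeries fun n => V n p

/-- The series of the first derivatives of the bulk profiles at a point. -/
def dProfileSeries (T : ℝ) (s : Side) (V : ℕ → (Fin 6 → ℝ) → Fin 7 → ℝ) (p : Fin 6 → ℝ)
    (i : Fin 6) : Fin 7 → ℝ⟦X⟧ :=
  vecSeries fun n => pd (bulkDomain T s) i (V n) p

/-- The series of the first derivatives of the fronts at a point. -/
def dFrontSeries (T : ℝ) (ψ : ℕ → (Fin 4 → ℝ) → ℝ) (q : Fin 4 → ℝ) (i : Fin 4) : ℝ⟦X⟧ :=
  PowerSeries.mk fun n => pd (frontDomain T) i (ψ n) q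

/-- The residual at order `n + 2` contains every term of `-F^n` together with the products of `U⁰`
and fast derivatives of `U^{n+1}`, which form the fast operator. Its vanishing is therefore the
cascade equation of `U^{n+1}`. -/
theorem sourceF_magIdx (P : SheetData) {χ : ℝ → ℝ} (hχ : IsCutoff χ) (T : ℝ) (s : Side)
    (ψ : ℕ → (Fin 4 → ℝ) → ℝ) (V : ℕ → (Fin 6 → ℝ) → Fin 7 → ℝ) (n : ℕ) {p : Fin 6 → ℝ}
    (hp : |p 3| < 1 / 3) (hV : V 0 p = P.refState s)
    (hdV : ∀ i, pd (bulkDomain T s) i (V 0) p = 0) (β : Fin 3) :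
    sourceF P χ T s ψ V n p (magIdx β) = fastOp P T s (V (n + 1)) p (magIdx β)
      - PowerSeries.coeff (n + 2) (magResidual P β (profileSeries V p) (dProfileSeries T s V p)
          (dFrontSeries T ψ (toFront p))) := by
  have e1 := fun i α =>
    coeff_inductionForm_of_zero α β (v := fun n => V n p)
      (w := fun n => pd (bulkDomain T s) i (V n) p) (hdV i)
  have e2 := fun i α f =>
    coeff_mk_mul_inductionForm α β f (v := fun n => V n p)
      (w := fun n => pd (bulkDomain T s) i (V n) p) (hdV i)
  rw [sourceF_eq_of_near P hχ T s ψ V n hp]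
  unfold magResidual profileSeries dProfileSeries dFrontSeries
  rw [coeff_residual_form]
  simp only [map_add, map_sub, map_sum, PowerSeries.coeff_C_mul,e1, e2, hV]
  simp only [slowOp, fastOp, SheetData.calA, Matrix.add_mulVec, Matrix.smul_mulVec,
    Pi.add_apply, Pi.sub_apply, Pi.neg_apply, Finset.sum_apply, Pi.smul_apply,
    smul_eq_mul, A_mulVec_magIdx, A0_mulVec_magIdx, hess_magIdx, vecSeries, PowerSeries.coeff_mul,
    PowerSeries.coeff_mk, Finset.sum_add_distrib, Fin.sum_univ_two, Fin.sum_univ_three, mul_add,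
    Finset.mul_sum, mul_left_comm _ (P.ξ _), mul_left_comm _ P.τ]
  simp only [show (yIdx 0) = 1 from rfl,
    show (yIdx 1) = 2 from rfl, show (yIdx 2) = 3 from rfl]
  simp only [← Finset.mul_sum]
  ring

/-- The last row of the fluxes is the linear map `U ↦ u_α`, so this component encodes `div u = 0`,
without `A₀` or Hessian contributions. -/
theorem sourceF_six (P : SheetData) {χ : ℝ → ℝ} (hχ : IsCutoff χ) (T : ℝ) (s : Side)
    (ψ : ℕ → (Fin 4 → ℝ) → ℝ) (V : ℕ → (Fin 6 → ℝ) → Fin 7 → ℝ) (n : ℕ) {p : Fin 6 → ℝ}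
    (hp : |p 3| < 1 / 3) :
    sourceF P χ T s ψ V n p 6 = fastOp P T s (V (n + 1)) p 6
      - PowerSeries.coeff (n + 2) (divResidual P velIdx (dProfileSeries T s V p)
          (dFrontSeries T ψ (toFront p))) := by
  rw [sourceF_eq_of_near P hχ T s ψ V n hp]
  unfold divResidual dProfileSeries dFrontSeries
  rw [coeff_residual_form]
  simp only [map_add, map_sub, map_sum, PowerSeries.coeff_C_mul]
  simp only [slowOp, fastOp, SheetData.calA, Matrix.add_mulVec, Matrix.smul_mulVec,
    Pi.add_apply, Pi.sub_apply, Pi.neg_apply, Finset.sum_apply, Pi.smul_apply,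
    smul_eq_mul, A_mulVec_six, A0_mulVec_six, hess_six, vecSeries, PowerSeries.coeff_mul,
    PowerSeries.coeff_mk, Finset.sum_add_distrib, Fin.sum_univ_two, Fin.sum_univ_three, mul_add,
    mul_left_comm _ (P.ξ _), mul_zero, Finset.sum_const_zero]
  simp only [show (yIdx 0) = 1 from rfl, show (yIdx 1) = 2 from rfl, show (yIdx 2) = 3 from rfl]
  simp only [← Finset.mul_sum]
  ring

theorem sourceF8_eq (P : SheetData) {χ : ℝ → ℝ} (hχ : IsCutoff χ) (T : ℝ) (s : Side)
    (ψ : ℕ → (Fin 4 → ℝ) → ℝ) (V : ℕ → (Fin 6 → ℝ) → Fin 7 → ℝ) (n : ℕ) {p : Fin 6 → ℝ}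
    (hp : |p 3| < 1 / 3) :
    sourceF8 P χ T s ψ V n p = pd (bulkDomain T s) 4 (V (n + 1)) p 5
      + ∑ j : Fin 2, P.ξ j * pd (bulkDomain T s) 5 (V (n + 1)) p (HIdx j)
      - PowerSeries.coeff (n + 2) (divResidual P magIdx (dProfileSeries T s V p)
          (dFrontSeries T ψ (toFront p))) := by
  have e3 : ∀ (k : ℕ) (f : (Fin 3 → ℕ) → ℝ) (g : ℕ × ℕ → ℝ),
      (∀ l, l 0 ≠ 0 → f l = 0) → (∀ r, f ![0, r.1, r.2] = g r) →
      ∑ l ∈ Finset.Nat.antidiagonalTuple 3 k, f l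
        = ∑ r ∈ Finset.HasAntidiagonal.antidiagonal k, g r := fun k f g hf hg => by
    rw [Finset.Nat.sum_antidiagonalTuple_three_head_zero k f hf]
    exact Finset.sum_congr rfl fun r _ => hg r
  unfold sourceF8 divResidual dProfileSeries dFrontSeries
  rw [coeff_residual_form]
  simp only [hχ.chiCoef_eq _ hp, hχ.chiDotCoef_eq _ hp, zero_mul, Finset.sum_const_zero, add_zero]
  rw [e3 (n + 1) _ (fun r => pd (frontDomain T) 3 (ψ r.1) (toFront p) *
      ∑ j : Fin 2, P.ξ j * pd (bulkDomain T s) 3 (V r.2) p (HIdx j))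
      (fun l hl => by simp [hl]) fun r => by simp,
    e3 n _ (fun r => ∑ j : Fin 2, pd (frontDomain T) (yFrontIdx j) (ψ r.1) (toFront p) *
      pd (bulkDomain T s) 3 (V r.2) p (HIdx j)) (fun l hl => by simp [hl]) fun r => by simp]
  simp only [map_add, map_sub, map_sum, PowerSeries.coeff_C_mul]
  simp only [vecSeries, PowerSeries.coeff_mul, PowerSeries.coeff_mk, Finset.sum_add_distrib,
    Fin.sum_univ_two, Fin.sum_univ_three, mul_add, mul_left_comm _ (P.ξ _)]
  simp only [← Finset.mul_sum]
  simp only [show (yIdx 0) = 1 from rfl, show (yIdx 1) = 2 from rfl, show (yIdx 2) = 3 from rfl,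
    show magIdx 0 = 3 from rfl, show magIdx 1 = 4 from rfl, show magIdx 2 = 5 from rfl,
    show HIdx 0 = 3 from rfl, show HIdx 1 = 4 from rfl, show Fin.castSucc (0 : Fin 2) = 0 from rfl,
    show Fin.castSucc (1 : Fin 2) = 1 from rfl]
  ring

/-- The source term `F₈^{n,±}` where the cut-off is `1` depends only on `U^ℓ`, `ℓ ≤ n`, and on `ψ^ℓ`,
`ℓ ≤ n + 1`. -/
theorem sourceF8_congr {P : SheetData} {χ : ℝ → ℝ} (hχ : IsCutoff χ) {T : ℝ} {s : Side}
    {ψ ψ' : ℕ → (Fin 4 → ℝ) → ℝ} {V V' : ℕ → (Fin 6 → ℝ) → Fin 7 → ℝ} {n : ℕ} {p : Fin 6 → ℝ}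
    (hp : |p 3| < 1 / 3) (hV : ∀ ℓ ≤ n, V ℓ = V' ℓ) (hψ : ∀ ℓ ≤ n + 1, ψ ℓ = ψ' ℓ)
    (h0 : ψ 0 = 0) (h1 : ψ 1 = 0) (hc : ∀ i, pd (bulkDomain T s) i (V 0) p = 0) :
    sourceF8 P χ T s ψ V n p = sourceF8 P χ T s ψ' V' n p := by
  have hdV : ∀ ℓ ≤ n, ∀ i, pd (bulkDomain T s) i (V ℓ) p = pd (bulkDomain T s) i (V' ℓ) p :=
    fun ℓ h i => by rw [hV ℓ h]
  have hdψ : ∀ ℓ ≤ n + 1, ∀ i, pd (frontDomain T) i (ψ ℓ) (toFront p)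
      = pd (frontDomain T) i (ψ' ℓ) (toFront p) := fun ℓ h i => by rw [hψ ℓ h]
  have hc' : ∀ i, pd (bulkDomain T s) i (V' 0) p = 0 := fun i => by rw [← hV 0 (Nat.zero_le _)]; exact hc i
  have hz : ∀ i, pd (frontDomain T) i (0 : (Fin 4 → ℝ) → ℝ) (toFront p) = 0 := by
    intro i; simp [pd]
  have z0 : ∀ i, pd (frontDomain T) i (ψ 0) (toFront p) = 0 := by rw [h0]; exact hz
  have z1 : ∀ i, pd (frontDomain T) i (ψ 1) (toFront p) = 0 := by rw [h1]; exact hz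
  have z0' : ∀ i, pd (frontDomain T) i (ψ' 0) (toFront p) = 0 := by
    rw [← hψ 0 (Nat.zero_le _), h0]; exact hz
  have z1' : ∀ i, pd (frontDomain T) i (ψ' 1) (toFront p) = 0 := by
    rw [← hψ 1 (by omega), h1]; exact hz
  unfold sourceF8
  simp only [hχ.chiCoef_eq _ hp, hχ.chiDotCoef_eq _ hp]
  simp only [hV n le_rfl]
  congr 1; congr 1; congr 1; congr 1; congr 1
  all_goals
    refine Finset.sum_congr rfl fun l hl => ?_
    simp only [Finset.HasAntidiagonal.mem_antidiagonal,
      Finset.Nat.mem_antidiagonalTuple, Fin.sum_univ_three] at hl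
  · rcases (by omega : (l.1 ≤ n + 1 ∧ l.2 ≤ n) ∨ l.1 = 0 ∨ l.1 = 1 ∨ l.2 = 0) with h | h | h | h
    · rw [hdV _ h.2, hdψ _ h.1]
    all_goals simp [h, hc, hc', z0, z0', z1, z1']
  · rcases (by omega : (l.1 ≤ n + 1 ∧ l.2 ≤ n) ∨ l.1 = 0 ∨ l.1 = 1 ∨ l.2 = 0) with h | h | h | h
    · simp only [hdV _ h.2, hdψ _ h.1]
    all_goals simp [h, hc, hc', z0, z0', z1, z1']
  · rcases (by omega : (l 1 ≤ n + 1 ∧ l 2 ≤ n) ∨ l 1 = 0 ∨ l 1 = 1 ∨ l 2 = 0) with h | h | h | h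
    · simp only [hdV _ h.2, hdψ _ h.1]
    all_goals simp [h, hc, hc', z0, z0', z1, z1']
  · rw [hdV _ (by omega)]
    simp only [hdψ (l 1) (by omega)]
  · simp

/-! ### The boundary source terms as coefficients of residual series. -/

/-- The residual of a boundary condition multiplied by `ε`, as a formal series in `ε`: the kinematic
condition for `idx = velIdx`, `κ = 1`, and the tangency of the magnetic field for `idx = magIdx`,
`κ = 0`. -/
def bdryResidual (P : SheetData) (κ : ℝ) (idx : Fin 3 → Fin 7) (v : Fin 7 → ℝ⟦X⟧)
    (d : Fin 4 → ℝ⟦X⟧) : ℝ⟦X⟧ :=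
  PowerSeries.X * v (idx 2)
  - PowerSeries.C κ * (PowerSeries.X * d 0 + PowerSeries.C P.τ * d 3)
  - ∑ j : Fin 2, (PowerSeries.X * d (yFrontIdx j) + PowerSeries.C (P.ξ j) * d 3)
      * v (idx j.castSucc)

/-- Isolates the contribution of the reference state: the sums in `G₁^m`, `G₂^m` run over `ℓ₂ ≥ 1`,
and the terms with `ℓ₂ = 0` are written apart from them. -/
theorem coeff_mk_mul_mk_split (f g : ℕ → ℝ) (n : ℕ) :
    PowerSeries.coeff n (PowerSeries.mk f * PowerSeries.mk g)
      = f n * g 0 + ∑ l ∈ Finset.HasAntidiagonal.antidiagonal n with 1 ≤ l.2, f l.1 * g l.2 := by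
  rw [PowerSeries.coeff_mul, ← Finset.add_sum_erase _ _ (a := (n, 0)) (by simp)]
  simp only [PowerSeries.coeff_mk]
  congr 1
  refine Finset.sum_congr ?_ fun _ _ => rfl
  ext l
  simp only [Finset.mem_filter, Finset.mem_erase, ne_eq, Prod.ext_iff,
    Finset.HasAntidiagonal.mem_antidiagonal]
  omega

theorem coeff_bdryResidual (P : SheetData) (κ : ℝ) (idx : Fin 3 → Fin 7) (v : ℕ → Fin 7 → ℝ)
    (d : Fin 4 → ℕ → ℝ) (n : ℕ) :
    PowerSeries.coeff (n + 1)
        (bdryResidual P κ idx (vecSeries v) fun i => PowerSeries.mk (d i))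
      = v n (idx 2) - κ * (d 0 n + P.τ * d 3 (n + 1))
        - (∑ j : Fin 2, (d (yFrontIdx j) n + P.ξ j * d 3 (n + 1)) * v 0 (idx j.castSucc)
          + ∑ l ∈ Finset.HasAntidiagonal.antidiagonal (n + 1) with 1 ≤ l.2,
              d 3 l.1 * ∑ j : Fin 2, P.ξ j * v l.2 (idx j.castSucc)
          + ∑ l ∈ Finset.HasAntidiagonal.antidiagonal n with 1 ≤ l.2,
              ∑ j : Fin 2, d (yFrontIdx j) l.1 * v l.2 (idx j.castSucc)) := by
  simp only [bdryResidual, vecSeries, map_sub, map_add, mul_assoc, add_mul,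
    PowerSeries.coeff_C_mul, PowerSeries.coeff_succ_X_mul, coeff_mk_mul_mk_split,
    PowerSeries.coeff_mk, Fin.sum_univ_two, mul_add, Finset.sum_add_distrib,
    mul_left_comm _ (P.ξ _)]
  simp only [← Finset.mul_sum]
  ring

/-- The front of index `n + 2` meets only `τ` and the reference velocity, whence the factor `c = τ +
ξ_j u_j⁰`. For the magnetic field `τ` is absent (`κ = 0`) and the factor is `b`. -/
theorem coeff_bdryResidual_vel (P : SheetData) (T : ℝ) (s : Side) (ψ : ℕ → (Fin 4 → ℝ) → ℝ)
    (V : ℕ → (Fin 6 → ℝ) → Fin 7 → ℝ) (n : ℕ) (q : Fin 4 → ℝ)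
    (hV : V 0 (toBoundary q) = P.refState s) :
    PowerSeries.coeff (n + 2) (bdryResidual P 1 velIdx (profileSeries V (toBoundary q))
        (dFrontSeries T ψ q))
      = V (n + 1) (toBoundary q) 2 - P.c s * pd (frontDomain T) 3 (ψ (n + 2)) q
        - sourceG1 P T s ψ V n q := by
  have := coeff_bdryResidual P 1 velIdx (fun n => V n (toBoundary q))
    (fun i n => pd (frontDomain T) i (ψ n) q) (n + 1)
  refine this.trans ?_
  simp only [hV, sourceG1, SheetData.c, SheetData.a, Fin.sum_univ_two, SheetData.refState,
    show velIdx 2 = 2 from rfl, show velIdx 0 = 0 from rfl, show velIdx 1 = 1 from rfl,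
    show uIdx 0 = 0 from rfl, show uIdx 1 = 1 from rfl, show Fin.castSucc (0 : Fin 2) = 0 from rfl,
    show Fin.castSucc (1 : Fin 2) = 1 from rfl, Matrix.cons_val_zero, Matrix.cons_val_one]
  ring

theorem coeff_bdryResidual_mag (P : SheetData) (T : ℝ) (s : Side) (ψ : ℕ → (Fin 4 → ℝ) → ℝ)
    (V : ℕ → (Fin 6 → ℝ) → Fin 7 → ℝ) (n : ℕ) (q : Fin 4 → ℝ)
    (hV : V 0 (toBoundary q) = P.refState s) :
    PowerSeries.coeff (n + 2) (bdryResidual P 0 magIdx (profileSeries V (toBoundary q))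
        (dFrontSeries T ψ q))
      = V (n + 1) (toBoundary q) 5 - P.b s * pd (frontDomain T) 3 (ψ (n + 2)) q
        - sourceG2 P T s ψ V n q := by
  have := coeff_bdryResidual P 0 magIdx (fun n => V n (toBoundary q))
    (fun i n => pd (frontDomain T) i (ψ n) q) (n + 1)
  refine this.trans ?_
  have h3 : P.refState s 3 = P.H0 s 0 := rfl
  have h4 : P.refState s 4 = P.H0 s 1 := rfl
  simp only [hV, sourceG2, SheetData.b, Fin.sum_univ_two,
    show magIdx 2 = 5 from rfl, show magIdx 0 = 3 from rfl, show magIdx 1 = 4 from rfl,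
    show HIdx 0 = 3 from rfl, show HIdx 1 = 4 from rfl, show Fin.castSucc (0 : Fin 2) = 0 from rfl,
    show Fin.castSucc (1 : Fin 2) = 1 from rfl, h3, h4]
  ring

/-- The boundary source term `G₁^{n,±}` depends only on `U^ℓ`, `ℓ ≤ n`, and on `ψ^ℓ`, `ℓ ≤ n + 1`. -/
theorem sourceG1_congr {P : SheetData} {T : ℝ} {s : Side}
    {ψ ψ' : ℕ → (Fin 4 → ℝ) → ℝ} {V V' : ℕ → (Fin 6 → ℝ) → Fin 7 → ℝ} {n : ℕ}
    (hV : ∀ ℓ ≤ n, V ℓ = V' ℓ) (hψ : ∀ ℓ ≤ n + 1, ψ ℓ = ψ' ℓ)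
    (h0 : ψ 0 = 0) (h1 : ψ 1 = 0) : sourceG1 P T s ψ V n = sourceG1 P T s ψ' V' n := by
  have h0' : ψ' 0 = 0 := by rw [← hψ 0 (by omega), h0]
  have h1' : ψ' 1 = 0 := by rw [← hψ 1 (by omega), h1]
  have hz : ∀ i q, pd (frontDomain T) i (0 : (Fin 4 → ℝ) → ℝ) q = 0 := by
    intro i q; simp [pd]
  funext q
  unfold sourceG1
  simp only [hψ (n + 1) le_rfl]
  congr 1; congr 1
  all_goals
    refine Finset.sum_congr rfl fun l hl => ?_
    simp only [Finset.mem_filter, Finset.HasAntidiagonal.mem_antidiagonal] at hl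
    rcases (by omega : (l.1 ≤ n + 1 ∧ l.2 ≤ n) ∨ l.1 = 0 ∨ l.1 = 1) with h | h | h
    · simp only [hV _ h.2, hψ _ h.1]
    all_goals simp [h, h0, h1, h0', h1', hz]

/-- The boundary source term `G₂^{n,±}` depends only on `U^ℓ`, `ℓ ≤ n`, and on `ψ^ℓ`, `ℓ ≤ n + 1`. -/
theorem sourceG2_congr {P : SheetData} {T : ℝ} {s : Side}
    {ψ ψ' : ℕ → (Fin 4 → ℝ) → ℝ} {V V' : ℕ → (Fin 6 → ℝ) → Fin 7 → ℝ} {n : ℕ}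
    (hV : ∀ ℓ ≤ n, V ℓ = V' ℓ) (hψ : ∀ ℓ ≤ n + 1, ψ ℓ = ψ' ℓ)
    (h0 : ψ 0 = 0) (h1 : ψ 1 = 0) : sourceG2 P T s ψ V n = sourceG2 P T s ψ' V' n := by
  have h0' : ψ' 0 = 0 := by rw [← hψ 0 (by omega), h0]
  have h1' : ψ' 1 = 0 := by rw [← hψ 1 (by omega), h1]
  have hz : ∀ i q, pd (frontDomain T) i (0 : (Fin 4 → ℝ) → ℝ) q = 0 := by
    intro i q; simp [pd]
  funext q
  unfold sourceG2
  simp only [hψ (n + 1) le_rfl]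
  congr 1; congr 1
  all_goals
    refine Finset.sum_congr rfl fun l hl => ?_
    simp only [Finset.mem_filter, Finset.HasAntidiagonal.mem_antidiagonal] at hl
    rcases (by omega : (l.1 ≤ n + 1 ∧ l.2 ≤ n) ∨ l.1 = 0 ∨ l.1 = 1) with h | h | h
    · simp only [hV _ h.2, hψ _ h.1]
    all_goals simp [h, h0, h1, h0', h1', hz]

/-! ### The algebraic identities between the residuals. -/

/-- The index of a front variable among the bulk variables. -/
def frontToBulkIdx (i : Fin 4) : Fin 6 := ![0, 1, 2, 5] i

/-- The derivative of `bdryResidual` in the `i`-th front variable, by the product rule. -/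
def dBdryResidual (P : SheetData) (κ : ℝ) (idx : Fin 3 → Fin 7) (v : Fin 7 → ℝ⟦X⟧)
    (dv : Fin 6 → Fin 7 → ℝ⟦X⟧) (d : Fin 4 → ℝ⟦X⟧) (dd : Fin 4 → Fin 4 → ℝ⟦X⟧) (i : Fin 4) : ℝ⟦X⟧ :=
  PowerSeries.X * dv (frontToBulkIdx i) (idx 2)
  - PowerSeries.C κ * (PowerSeries.X * dd i 0 + PowerSeries.C P.τ * dd i 3)
  - ∑ j : Fin 2, ((PowerSeries.X * dd i (yFrontIdx j) + PowerSeries.C (P.ξ j) * dd i 3)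
        * v (idx j.castSucc)
      + (PowerSeries.X * d (yFrontIdx j) + PowerSeries.C (P.ξ j) * d 3)
        * dv (frontToBulkIdx i) (idx j.castSucc))

/-- The derivative `ε (∂_t + u_j ∂_j) H_β - ε H_j ∂_j u_β` along the front, in the variables of the
two-scale expansion. -/
def transportSeries (P : SheetData) (v : Fin 7 → ℝ⟦X⟧) (dv : Fin 6 → Fin 7 → ℝ⟦X⟧) (β : Fin 3) :
    ℝ⟦X⟧ :=
  PowerSeries.X * dv 0 (magIdx β) + PowerSeries.C P.τ * dv 5 (magIdx β)
  + ∑ j : Fin 2, (v (velIdx j.castSucc)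
        * (PowerSeries.X * dv (yIdx j.castSucc) (magIdx β) + PowerSeries.C (P.ξ j) * dv 5 (magIdx β))
      - v (magIdx j.castSucc)
        * (PowerSeries.X * dv (yIdx j.castSucc) (velIdx β) + PowerSeries.C (P.ξ j) * dv 5 (velIdx β)))

/-- The product rule for `∂_α (u_α H_β - H_α u_β)`. Straightening the front replaces each tangential
or time derivative by itself minus a slope times the normal derivative `X * dv 3 + dv 4`. The
coefficients of the normal derivatives of `H_β` and `u_β` are then exactly the two boundary
residuals, read here at any point and not only on the front. -/
theorem magResidual_eq_transport (P : SheetData) (v : Fin 7 → ℝ⟦X⟧) (dv : Fin 6 → Fin 7 → ℝ⟦X⟧)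
    (d : Fin 4 → ℝ⟦X⟧) (β : Fin 3) :
    magResidual P β v dv d = PowerSeries.X * transportSeries P v dv β
      + v (magIdx β) * divResidual P velIdx dv d - v (velIdx β) * divResidual P magIdx dv d
      + bdryResidual P 1 velIdx v d * (PowerSeries.X * dv 3 (magIdx β) + dv 4 (magIdx β))
      - bdryResidual P 0 magIdx v d * (PowerSeries.X * dv 3 (velIdx β) + dv 4 (velIdx β)) := by
  simp only [magResidual, transportSeries, divResidual, bdryResidual, inductionForm,
    Fin.sum_univ_two, Fin.sum_univ_three, show (yIdx 0) = 1 from rfl, show (yIdx 1) = 2 from rfl,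
    show (yIdx 2) = 3 from rfl, show Fin.castSucc (0 : Fin 2) = 0 from rfl,
    show Fin.castSucc (1 : Fin 2) = 1 from rfl, map_zero, map_one]
  ring

/-- Differentiate `B_H` along `∂_t + u_j ∂_j` and `B_u` along `H_j ∂_j`, and subtract. The second
derivatives of the front cancel by symmetry, and the derivatives falling on the tangential
components regroup as slopes times the tangential transport. -/
theorem transport_normal_eq (P : SheetData) (v : Fin 7 → ℝ⟦X⟧) (dv : Fin 6 → Fin 7 → ℝ⟦X⟧)
    (d : Fin 4 → ℝ⟦X⟧) (dd : Fin 4 → Fin 4 → ℝ⟦X⟧) (hdd : ∀ i k, dd i k = dd k i) :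
    PowerSeries.X * transportSeries P v dv 2 =
      PowerSeries.X * dBdryResidual P 0 magIdx v dv d dd 0
      + PowerSeries.C P.τ * dBdryResidual P 0 magIdx v dv d dd 3
      + ∑ j : Fin 2, (v (velIdx j.castSucc)
          * (PowerSeries.X * dBdryResidual P 0 magIdx v dv d dd (yFrontIdx j)
            + PowerSeries.C (P.ξ j) * dBdryResidual P 0 magIdx v dv d dd 3)
        - v (magIdx j.castSucc)
          * (PowerSeries.X * dBdryResidual P 1 velIdx v dv d dd (yFrontIdx j)
            + PowerSeries.C (P.ξ j) * dBdryResidual P 1 velIdx v dv d dd 3))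
      + ∑ k : Fin 2, (PowerSeries.X * d (yFrontIdx k) + PowerSeries.C (P.ξ k) * d 3)
          * transportSeries P v dv k.castSucc := by
  simp only [transportSeries, dBdryResidual, frontToBulkIdx,
    Fin.sum_univ_two, show (yIdx 0) = 1 from rfl, show (yIdx 1) = 2 from rfl,
    show Fin.castSucc (0 : Fin 2) = 0 from rfl,
    show (yFrontIdx 0) = 1 from rfl, show (yFrontIdx 1) = 2 from rfl,
    show Fin.castSucc (1 : Fin 2) = 1 from rfl, map_zero, map_one, Matrix.cons_val]
  rw [hdd 1 0, hdd 2 0, hdd 3 0, hdd 2 1, hdd 3 1, hdd 3 2]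
  ring

/-- The order `ε^{N+1}` of the residual of the equation of `H₃` when all other residuals are
`O(ε^N)`. -/
theorem magResidual_normal_congr (P : SheetData) {v : Fin 7 → ℝ⟦X⟧} {dv : Fin 6 → Fin 7 → ℝ⟦X⟧}
    {d : Fin 4 → ℝ⟦X⟧} {dd : Fin 4 → Fin 4 → ℝ⟦X⟧} (hdd : ∀ i k, dd i k = dd k i) {N : ℕ}
    (hv : ∀ k, k = 2 ∨ k = 5 → PowerSeries.X ∣ v k) (hdv : ∀ i k, PowerSeries.X ∣ dv i k)
    (hd : ∀ i, PowerSeries.X ^ 2 ∣ d i)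
    (hmag : ∀ k : Fin 2, PowerSeries.X ^ N ∣ magResidual P k.castSucc v dv d)
    (hdivu : PowerSeries.X ^ N ∣ divResidual P velIdx dv d)
    (hdivH : PowerSeries.X ^ N ∣ divResidual P magIdx dv d)
    (hbu : PowerSeries.X ^ N ∣ bdryResidual P 1 velIdx v d)
    (hbH : PowerSeries.X ^ N ∣ bdryResidual P 0 magIdx v d) :
    PowerSeries.X ^ (N + 1) ∣ magResidual P 2 v dv d
      - (PowerSeries.X * dBdryResidual P 0 magIdx v dv d dd 0
      + PowerSeries.C P.τ * dBdryResidual P 0 magIdx v dv d dd 3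
      + ∑ j : Fin 2, (v (velIdx j.castSucc)
          * (PowerSeries.X * dBdryResidual P 0 magIdx v dv d dd (yFrontIdx j)
            + PowerSeries.C (P.ξ j) * dBdryResidual P 0 magIdx v dv d dd 3)
        - v (magIdx j.castSucc)
          * (PowerSeries.X * dBdryResidual P 1 velIdx v dv d dd (yFrontIdx j)
            + PowerSeries.C (P.ξ j) * dBdryResidual P 1 velIdx v dv d dd 3))) := by
  have hE : ∀ k, PowerSeries.X ∣ (PowerSeries.X * dv 3 k + dv 4 k : ℝ⟦X⟧) := fun k =>
    dvd_add (Dvd.intro _ rfl) (hdv 4 k)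
  -- The first identity, solved for the transport term, at `β = 1, 2`.
  have htr : ∀ k : Fin 2, PowerSeries.X ^ N ∣ PowerSeries.X * transportSeries P v dv k.castSucc := by
    intro k
    have h := magResidual_eq_transport P v dv d k.castSucc
    rw [show PowerSeries.X * transportSeries P v dv k.castSucc = magResidual P k.castSucc v dv d
      - v (magIdx k.castSucc) * divResidual P velIdx dv d
      + v (velIdx k.castSucc) * divResidual P magIdx dv d
      - bdryResidual P 1 velIdx v d
        * (PowerSeries.X * dv 3 (magIdx k.castSucc) + dv 4 (magIdx k.castSucc))
      + bdryResidual P 0 magIdx v d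
        * (PowerSeries.X * dv 3 (velIdx k.castSucc) + dv 4 (velIdx k.castSucc)) by rw [h]; ring]
    exact dvd_add (dvd_sub (dvd_add (dvd_sub (hmag k) (hdivu.mul_left _)) (hdivH.mul_left _))
      (hbu.mul_right _)) (hbH.mul_right _)
  -- The slope is `O(X²)`: one factor `X` completes `X * transportSeries`, which is `O(X^N)`, and
  -- the other gives the gain.
  have hK : ∀ k : Fin 2, PowerSeries.X ^ (N + 1) ∣
      (PowerSeries.X * d (yFrontIdx k) + PowerSeries.C (P.ξ k) * d 3)
          * transportSeries P v dv k.castSucc := by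
    intro k
    obtain ⟨w, hw⟩ : PowerSeries.X ^ 2 ∣
        (PowerSeries.X * d (yFrontIdx k) + PowerSeries.C (P.ξ k) * d 3) :=
      dvd_add ((hd _).mul_left _) ((hd _).mul_left _)
    rw [hw, show PowerSeries.X ^ 2 * w * transportSeries P v dv k.castSucc
      = (PowerSeries.X * transportSeries P v dv k.castSucc) * PowerSeries.X * w by ring, pow_succ]
    exact (mul_dvd_mul_right (htr k) _).mul_right _
  rw [magResidual_eq_transport, transport_normal_eq P v dv d dd hdd]
  have e : ∀ a b c₁ c₂ c₃ c₄ : ℝ⟦X⟧, a + b + c₁ - c₂ + c₃ - c₄ - a = b + c₁ - c₂ + c₃ - c₄ := by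
    intros; ring
  rw [e, pow_succ]
  -- Besides the slope terms, each product pairs a residual `O(X^N)` with a factor `O(X)`: `H₃`,
  -- `u₃`, or a normal derivative.
  refine dvd_sub (dvd_add (dvd_sub (dvd_add ?_ ?_) ?_) ?_) ?_
  · rw [← pow_succ]
    exact Finset.dvd_sum fun k _ => hK k
  · rw [mul_comm (v _)]
    exact mul_dvd_mul hdivu (hv _ (Or.inr rfl))
  · rw [mul_comm (v _)]
    exact mul_dvd_mul hdivH (hv _ (Or.inl rfl))
  · exact mul_dvd_mul hbu (hE _)
  · exact mul_dvd_mul hbH (hE _)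

/-! ### Divisibility of the residuals by powers of `ε`. -/

section Divisibility

variable {P : SheetData} {v : Fin 7 → ℝ⟦X⟧} {dv : Fin 6 → Fin 7 → ℝ⟦X⟧} {d : Fin 4 → ℝ⟦X⟧}

theorem dvd_inductionForm {R : Type*} [CommRing R] {a : R} (α β : Fin 3) (v : Fin 7 → R)
    {w : Fin 7 → R} (hw : ∀ k, a ∣ w k) : a ∣ inductionForm α β v w :=
  dvd_sub (dvd_sub (dvd_add ((hw _).mul_left _) ((hw _).mul_left _)) ((hw _).mul_left _))
    ((hw _).mul_left _)

/-- The cascade controls the coefficients from order `2` on. The two lowest ones vanish because the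
reference state is constant and the fronts start at `ε²`. -/
theorem X_sq_dvd_magResidual (β : Fin 3) (hdv : ∀ i k, PowerSeries.X ∣ dv i k)
    (hd : ∀ i, PowerSeries.X ^ 2 ∣ d i) : PowerSeries.X ^ 2 ∣ magResidual P β v dv d := by
  have hd1 : ∀ i, PowerSeries.X ∣ d i := fun i => (dvd_pow_self _ two_ne_zero).trans (hd i)
  unfold magResidual
  refine dvd_sub (dvd_add (Dvd.intro _ rfl) ?_) (dvd_add (((hd _).mul_right _).mul_left _)
    (Finset.dvd_sum fun j _ => ((hd _).mul_right _).mul_left _))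
  rw [pow_one, sq]
  refine mul_dvd_mul_left _ (dvd_sub (dvd_sub (dvd_add (dvd_add ((hdv _ _).mul_left _)
    (Finset.dvd_sum fun j _ => (dvd_inductionForm _ _ _ (hdv _)).mul_left _))
    (dvd_inductionForm _ _ _ (hdv _))) (dvd_add ((hd1 _).mul_right _)
    (Finset.dvd_sum fun j _ => (hd1 _).mul_right _))) (dvd_add (((hd1 _).mul_right _).mul_left _)
    (Finset.dvd_sum fun j _ => ((hd1 _).mul_right _).mul_left _)))

theorem X_sq_dvd_divResidual (idx : Fin 3 → Fin 7) (hdv : ∀ i k, PowerSeries.X ∣ dv i k)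
    (hd : ∀ i, PowerSeries.X ^ 2 ∣ d i) : PowerSeries.X ^ 2 ∣ divResidual P idx dv d := by
  have hd1 : ∀ i, PowerSeries.X ∣ d i := fun i => (dvd_pow_self _ two_ne_zero).trans (hd i)
  unfold divResidual
  refine dvd_sub (dvd_add (Dvd.intro _ rfl) ?_)
    (Finset.dvd_sum fun j _ => ((hd _).mul_right _).mul_left _)
  rw [pow_one, sq]
  exact mul_dvd_mul_left _ (dvd_sub (dvd_sub (dvd_add
    (Finset.dvd_sum fun j _ => (hdv _ _).mul_left _) (hdv _ _))
    (Finset.dvd_sum fun j _ => (hd1 _).mul_right _))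
    (Finset.dvd_sum fun j _ => ((hd1 _).mul_right _).mul_left _))

theorem X_sq_dvd_bdryResidual (κ : ℝ) (idx : Fin 3 → Fin 7) (hv : PowerSeries.X ∣ v (idx 2))
    (hd : ∀ i, PowerSeries.X ^ 2 ∣ d i) : PowerSeries.X ^ 2 ∣ bdryResidual P κ idx v d := by
  unfold bdryResidual
  refine dvd_sub (dvd_sub ?_ (Dvd.dvd.mul_left (dvd_add ((hd _).mul_left _) ((hd _).mul_left _)) _))
    (Finset.dvd_sum fun j _ =>
      Dvd.dvd.mul_right (dvd_add ((hd _).mul_left _) ((hd _).mul_left _)) _)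
  rw [sq]
  exact mul_dvd_mul_left _ hv

/-- Divisibility by `X ^ (N + 2)` from divisibility by `X ^ 2` and the vanishing of further
coefficients. -/
theorem X_pow_add_two_dvd {F : ℝ⟦X⟧} {N : ℕ} (h2 : PowerSeries.X ^ 2 ∣ F)
    (h : ∀ n < N, PowerSeries.coeff (n + 2) F = 0) : PowerSeries.X ^ (N + 2) ∣ F := by
  rw [PowerSeries.X_pow_dvd_iff] at h2 ⊢
  intro k hk
  by_cases hk2 : k < 2
  · exact h2 k hk2
  · obtain ⟨n, rfl⟩ := Nat.exists_eq_add_of_le' (not_lt.mp hk2)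
    exact h n (by omega)

theorem coeff_mul_of_X_pow_dvd {F : ℝ⟦X⟧} {N : ℕ} (h : PowerSeries.X ^ N ∣ F) (G : ℝ⟦X⟧) :
    PowerSeries.coeff N (G * F) = PowerSeries.coeff 0 G * PowerSeries.coeff N F := by
  obtain ⟨H, rfl⟩ := h
  rw [mul_left_comm]
  have := PowerSeries.coeff_X_pow_mul (R := ℝ) (G * H) N 0
  have h' := PowerSeries.coeff_X_pow_mul (R := ℝ) H N 0
  rw [zero_add] at this h'
  rw [this, h', PowerSeries.coeff_mul]
  simp

end Divisibility

/-! ### Coefficientwise continuity of the residual series. -/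

section CoeffContinuity

/-- All coefficients of a family of formal series are continuous. -/
def CoeffContinuousOn {α : Type*} [TopologicalSpace α] (F : α → ℝ⟦X⟧) (D : Set α) : Prop :=
  ∀ n, ContinuousOn (fun p => PowerSeries.coeff n (F p)) D

variable {α : Type*} [TopologicalSpace α] {F G : α → ℝ⟦X⟧} {D : Set α}

theorem CoeffContinuousOn.const (f : ℝ⟦X⟧) : CoeffContinuousOn (fun _ : α => f) D :=
  fun _ => continuousOn_const

theorem CoeffContinuousOn.add (hF : CoeffContinuousOn F D) (hG : CoeffContinuousOn G D) :
    CoeffContinuousOn (fun p => F p + G p) D := fun n => by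
  simp only [map_add]
  exact (hF n).add (hG n)

theorem CoeffContinuousOn.sub (hF : CoeffContinuousOn F D) (hG : CoeffContinuousOn G D) :
    CoeffContinuousOn (fun p => F p - G p) D := fun n => by
  simp only [map_sub]
  exact (hF n).sub (hG n)

theorem CoeffContinuousOn.mul (hF : CoeffContinuousOn F D) (hG : CoeffContinuousOn G D) :
    CoeffContinuousOn (fun p => F p * G p) D := fun n => by
  simp only [PowerSeries.coeff_mul]
  exact continuousOn_finsetSum _ fun l _ => (hF _).mul (hG _)

theorem CoeffContinuousOn.sum {ι : Type*} {s : Finset ι} {F : ι → α → ℝ⟦X⟧}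
    (hF : ∀ i, CoeffContinuousOn (F i) D) : CoeffContinuousOn (fun p => ∑ i ∈ s, F i p) D := fun n => by
  simp only [map_sum]
  exact continuousOn_finsetSum _ fun l _ => hF l n

variable {v : α → Fin 7 → ℝ⟦X⟧} {dv : α → Fin 6 → Fin 7 → ℝ⟦X⟧} {d : α → Fin 4 → ℝ⟦X⟧}

theorem CoeffContinuousOn.inductionForm {w : α → Fin 7 → ℝ⟦X⟧} (a b : Fin 3)
    (hv : ∀ k, CoeffContinuousOn (fun p => v p k) D) (hw : ∀ k, CoeffContinuousOn (fun p => w p k) D) :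
    CoeffContinuousOn (fun p => inductionForm a b (v p) (w p)) D :=
  ((((hv _).mul (hw _)).add ((hv _).mul (hw _))).sub ((hv _).mul (hw _))).sub ((hv _).mul (hw _))

theorem CoeffContinuousOn.magResidual (P : SheetData) (β : Fin 3)
    (hv : ∀ k, CoeffContinuousOn (fun p => v p k) D)
    (hdv : ∀ i k, CoeffContinuousOn (fun p => dv p i k) D)
    (hd : ∀ i, CoeffContinuousOn (fun p => d p i) D) :
    CoeffContinuousOn (fun p => magResidual P β (v p) (dv p) (d p)) D := by
  have hf : ∀ a i, CoeffContinuousOn (fun p => _root_.inductionForm a β (v p) (dv p i)) D :=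
    fun a i => CoeffContinuousOn.inductionForm a β hv (hdv i)
  exact ((((CoeffContinuousOn.const _).mul (((hdv _ _).add (.sum fun _ => hf _ _)).sub
    (((hd _).mul (hdv _ _)).add (.sum fun _ => (hd _).mul (hf _ _)))))).add
    ((CoeffContinuousOn.const _).mul (((((((CoeffContinuousOn.const _).mul (hdv _ _)).add
      (.sum fun _ => (CoeffContinuousOn.const _).mul (hf _ _)))).add (hf _ _)).sub
      (((hd _).mul (hdv _ _)).add (.sum fun _ => (hd _).mul (hf _ _)))).sub
      (((CoeffContinuousOn.const _).mul ((hd _).mul (hdv _ _))).add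
        (.sum fun _ => (CoeffContinuousOn.const _).mul ((hd _).mul (hf _ _))))))).sub
    (((CoeffContinuousOn.const _).mul ((hd _).mul (hdv _ _))).add
        (.sum fun _ => (CoeffContinuousOn.const _).mul ((hd _).mul (hf _ _))))

theorem CoeffContinuousOn.divResidual (P : SheetData) (idx : Fin 3 → Fin 7)
    (hdv : ∀ i k, CoeffContinuousOn (fun p => dv p i k) D)
    (hd : ∀ i, CoeffContinuousOn (fun p => d p i) D) :
    CoeffContinuousOn (fun p => divResidual P idx (dv p) (d p)) D :=
  (((CoeffContinuousOn.const _).mul ((CoeffContinuousOn.sum fun _ => hdv _ _).sub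
    (.sum fun _ => (hd _).mul (hdv _ _)))).add
    ((CoeffContinuousOn.const _).mul ((((CoeffContinuousOn.sum fun _ =>
      (CoeffContinuousOn.const _).mul (hdv _ _)).add (hdv _ _)).sub
      (.sum fun _ => (hd _).mul (hdv _ _))).sub
      (.sum fun _ => (CoeffContinuousOn.const _).mul ((hd _).mul (hdv _ _)))))).sub
    (.sum fun _ => (CoeffContinuousOn.const _).mul ((hd _).mul (hdv _ _)))

end CoeffContinuity

/-! ### Coefficientwise differentiation of formal series. -/

section CoeffDerivative

variable {n : ℕ} {D : Set (Fin n → ℝ)} {i : Fin n} {q : Fin n → ℝ}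

/-- `F'` is the coefficientwise derivative at `q`, in the `i`-th variable, of a family `F` of formal
series which is coefficientwise differentiable within `D`. -/
def HasCoeffPd (D : Set (Fin n → ℝ)) (i : Fin n) (F : (Fin n → ℝ) → ℝ⟦X⟧) (F' : ℝ⟦X⟧)
    (q : Fin n → ℝ) : Prop :=
  ∀ k, ∃ f' : (Fin n → ℝ) →L[ℝ] ℝ, HasFDerivWithinAt (fun q => PowerSeries.coeff k (F q)) f' D q ∧
    f' (Pi.single i 1) = PowerSeries.coeff k F'

variable {F G : (Fin n → ℝ) → ℝ⟦X⟧} {F' G' : ℝ⟦X⟧}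

theorem HasCoeffPd.add (hF : HasCoeffPd D i F F' q) (hG : HasCoeffPd D i G G' q) :
    HasCoeffPd D i (fun q => F q + G q) (F' + G') q := fun k => by
  obtain ⟨f, hf, hf'⟩ := hF k
  obtain ⟨g, hg, hg'⟩ := hG k
  refine ⟨f + g, ?_, by simp [hf', hg']⟩
  simp only [map_add]
  exact hf.add hg

theorem HasCoeffPd.sub (hF : HasCoeffPd D i F F' q) (hG : HasCoeffPd D i G G' q) :
    HasCoeffPd D i (fun q => F q - G q) (F' - G') q := fun k => by
  obtain ⟨f, hf, hf'⟩ := hF k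
  obtain ⟨g, hg, hg'⟩ := hG k
  refine ⟨f - g, ?_, by simp [hf', hg']⟩
  simp only [map_sub]
  exact hf.sub hg

theorem HasCoeffPd.sum {ι : Type*} {s : Finset ι} {F : ι → (Fin n → ℝ) → ℝ⟦X⟧} {F' : ι → ℝ⟦X⟧}
    (hF : ∀ j, HasCoeffPd D i (F j) (F' j) q) :
    HasCoeffPd D i (fun q => ∑ j ∈ s, F j q) (∑ j ∈ s, F' j) q := fun k => by
  choose f hf hf' using fun j => hF j k
  refine ⟨∑ j ∈ s, f j, ?_, by simp [hf']⟩
  simpa only [map_sum] using HasFDerivWithinAt.fun_sum fun j _ => hf j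

theorem HasCoeffPd.mul (hF : HasCoeffPd D i F F' q) (hG : HasCoeffPd D i G G' q) :
    HasCoeffPd D i (fun q => F q * G q) (F' * G q + F q * G') q := fun k => by
  choose f hf hf' using hF
  choose g hg hg' using hG
  simp only [PowerSeries.coeff_mul]
  refine ⟨_, HasFDerivWithinAt.fun_sum fun l _ => (hf l.1).mul (hg l.2), ?_⟩
  rw [map_add, PowerSeries.coeff_mul, PowerSeries.coeff_mul, ← Finset.sum_add_distrib,
    _root_.sum_apply]
  refine Finset.sum_congr rfl fun l _ => ?_
  simp only [_root_.add_apply, _root_.smul_apply, smul_eq_mul, hf', hg']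
  ring

theorem HasCoeffPd.const_mul (c : ℝ⟦X⟧) (hF : HasCoeffPd D i F F' q) :
    HasCoeffPd D i (fun q => c * F q) (c * F') q := fun k => by
  choose f hf hf' using hF
  simp only [PowerSeries.coeff_mul]
  refine ⟨_, HasFDerivWithinAt.fun_sum fun l _ => (hf l.2).const_mul _, ?_⟩
  simp [hf']

theorem HasCoeffPd.coeff_eq (hF : HasCoeffPd D i F F' q) (hD : UniqueDiffWithinAt ℝ D q) (k : ℕ) :
    PowerSeries.coeff k F' = pd D i (fun q => PowerSeries.coeff k (F q)) q := by
  obtain ⟨f, hf, hf'⟩ := hF k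
  rw [pd, hf.fderivWithin hD, hf']

end CoeffDerivative

theorem HasCoeffPd.bdryResidual {P : SheetData} {κ : ℝ} {idx : Fin 3 → Fin 7}
    {D : Set (Fin 4 → ℝ)} {i : Fin 4} {q : Fin 4 → ℝ} {v : (Fin 4 → ℝ) → Fin 7 → ℝ⟦X⟧}
    {dv : Fin 6 → Fin 7 → ℝ⟦X⟧} {d : (Fin 4 → ℝ) → Fin 4 → ℝ⟦X⟧} {dd : Fin 4 → Fin 4 → ℝ⟦X⟧}
    (hv : ∀ k, HasCoeffPd D i (fun q => v q k) (dv (frontToBulkIdx i) k) q)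
    (hd : ∀ k, HasCoeffPd D i (fun q => d q k) (dd i k) q) :
    HasCoeffPd D i (fun q => bdryResidual P κ idx (v q) (d q))
      (dBdryResidual P κ idx (v q) dv (d q) dd i) q :=
  (((hv _).const_mul _).sub ((((hd _).const_mul _).add ((hd _).const_mul _)).const_mul _)).sub
    (.sum fun _ => (((hd _).const_mul _).add ((hd _).const_mul _)).mul (hv _))

/-! ### Geometry of the domains and passage to the trace. -/

section Domains

variable {T : ℝ} {s : Side}

theorem Side.sgn_mul_sgn (s : Side) : s.sgn * s.sgn = 1 := by
  cases s <;> norm_num [Side.sgn]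

theorem convex_bulkDomain (T : ℝ) (s : Side) : Convex ℝ (bulkDomain T s) := by
  have h0 : Convex ℝ {p : Fin 6 → ℝ | p 0 ∈ Set.Icc 0 T} :=
    (convex_Icc 0 T).linear_preimage (LinearMap.proj 0 : (Fin 6 → ℝ) →ₗ[ℝ] ℝ)
  have h3 : Convex ℝ {p : Fin 6 → ℝ | s.sgn * p 3 ∈ Set.Icc (0 : ℝ) 1} :=
    (convex_Icc 0 1).is_linear_preimage
      (f := fun p : Fin 6 → ℝ => s.sgn * p 3) ⟨fun x y => mul_add _ _ _, fun c x => mul_left_comm _ _ _⟩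
  have h4 : Convex ℝ {p : Fin 6 → ℝ | s.sgn * p 4 ∈ Set.Ici (0 : ℝ)} :=
    (convex_Ici 0).is_linear_preimage
      (f := fun p : Fin 6 → ℝ => s.sgn * p 4) ⟨fun x y => mul_add _ _ _, fun c x => mul_left_comm _ _ _⟩
  exact h0.inter (h3.inter h4)

theorem uniqueDiffOn_bulkDomain (hT : 0 < T) : UniqueDiffOn ℝ (bulkDomain T s) := by
  refine uniqueDiffOn_convex (convex_bulkDomain T s) ?_
  have ho : IsOpen {p : Fin 6 → ℝ | p 0 ∈ Set.Ioo 0 T ∧ s.sgn * p 3 ∈ Set.Ioo (0 : ℝ) 1 ∧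
      s.sgn * p 4 ∈ Set.Ioi (0 : ℝ)} :=
    (isOpen_Ioo.preimage (by fun_prop : Continuous fun p : Fin 6 → ℝ => p 0)).inter
      ((isOpen_Ioo.preimage (by fun_prop : Continuous fun p : Fin 6 → ℝ => s.sgn * p 3)).inter
        (isOpen_Ioi.preimage (by fun_prop : Continuous fun p : Fin 6 → ℝ => s.sgn * p 4)))
  refine ⟨![T / 2, 0, 0, s.sgn * (1 / 2), s.sgn, 0], interior_maximal ?_ ho ?_⟩
  · rintro p ⟨h0, h3, h4⟩
    exact ⟨Set.Ioo_subset_Icc_self h0, Set.Ioo_subset_Icc_self h3, le_of_lt h4⟩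
  · have h := s.sgn_mul_sgn
    refine ⟨⟨?_, ?_⟩, ?_, ?_⟩
    · simp [hT]
    · simp [hT]
    · show s.sgn * (s.sgn * (1 / 2)) ∈ _
      rw [← mul_assoc, h]; norm_num
    · show 0 < s.sgn * s.sgn
      rw [h]; norm_num

/-- Both properties matter at the times `0` and `T`, where derivatives are one-sided: the first for
the symmetry of second derivatives, the second for the uniqueness of derivatives. -/
theorem subset_closure_interior_frontDomain (hT : 0 < T) :
    frontDomain T ⊆ closure (interior (frontDomain T)) ∧ UniqueDiffOn ℝ (frontDomain T) := by
  have hc : Convex ℝ (frontDomain T) :=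
    (convex_Icc 0 T).linear_preimage (LinearMap.proj 0 : (Fin 4 → ℝ) →ₗ[ℝ] ℝ)
  have hn : (interior (frontDomain T)).Nonempty := by
    have ho : IsOpen {p : Fin 4 → ℝ | p 0 ∈ Set.Ioo 0 T} :=
      isOpen_Ioo.preimage (by fun_prop : Continuous fun p : Fin 4 → ℝ => p 0)
    refine ⟨![T / 2, 0, 0, 0], interior_maximal (t := {p : Fin 4 → ℝ | p 0 ∈ Set.Ioo 0 T})
      (fun p hp => show p 0 ∈ Set.Icc 0 T from ⟨hp.1.le, hp.2.le⟩) ho ?_⟩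
    simp [hT]
  refine ⟨?_, uniqueDiffOn_convex hc hn⟩
  rw [hc.closure_interior_eq_closure_of_nonempty_interior hn]
  exact subset_closure

theorem toFront_toBoundary (q : Fin 4 → ℝ) : toFront (toBoundary q) = q := by
  ext i; fin_cases i <;> rfl

theorem toBoundary_mem {q : Fin 4 → ℝ} (hq : q ∈ frontDomain T) : toBoundary q ∈ bulkDomain T s := by
  refine ⟨hq, ?_, ?_⟩ <;> simp [toBoundary]

theorem toFront_mem {p : Fin 6 → ℝ} (hp : p ∈ bulkDomain T s) : toFront p ∈ frontDomain T := hp.1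

theorem bulkInterior_subset : bulkInterior T s ⊆ bulkDomain T s :=
  fun _ hp => ⟨hp.1, Set.Ioo_subset_Icc_self hp.2.1, le_of_lt hp.2.2⟩

/-- The point is approached along `y₃ = Y₃ = ±x` with `x → 0⁺`, which stays in the region where the
cut-off is `1`. -/
theorem toBoundary_mem_closure {q : Fin 4 → ℝ} (hq : q ∈ frontDomain T) :
    toBoundary q ∈ closure {p ∈ bulkInterior T s | |p 3| < 1 / 3} := by
  have hlim : Filter.Tendsto (fun x : ℝ => (![q 0, q 1, q 2, s.sgn * x, s.sgn * x, q 3] : Fin 6 → ℝ))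
      (nhdsWithin 0 (Set.Ioi 0)) (nhds (toBoundary q)) := by
    have hc : Continuous fun x : ℝ => (![q 0, q 1, q 2, s.sgn * x, s.sgn * x, q 3] : Fin 6 → ℝ) := by
      fun_prop
    have := (hc.tendsto 0).mono_left (nhdsWithin_le_nhds (s := Set.Ioi 0))
    simpa [toBoundary] using this
  refine mem_closure_of_tendsto hlim ?_
  filter_upwards [Ioo_mem_nhdsGT (show (0 : ℝ) < 1 / 3 by norm_num)] with x hx
  have h : s.sgn * (s.sgn * x) = x := by rw [← mul_assoc, s.sgn_mul_sgn, one_mul]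
  have habs : |s.sgn * x| = x := by
    rw [abs_mul, abs_of_pos hx.1]
    cases s <;> simp [Side.sgn]
  refine ⟨⟨hq, ?_, ?_⟩, ?_⟩
  · show s.sgn * (s.sgn * x) ∈ _
    rw [h]
    exact ⟨hx.1, hx.2.trans (by norm_num)⟩
  · show 0 < s.sgn * (s.sgn * x)
    rw [h]
    exact hx.1
  · show |s.sgn * x| < 1 / 3
    rw [habs]
    exact hx.2

/-- A family of formal series with continuous coefficients which is divisible by `X ^ N` inside the domain
near the front is divisible by `X ^ N` on the front. -/
theorem X_pow_dvd_toBoundary {F : (Fin 6 → ℝ) → ℝ⟦X⟧} {N : ℕ}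
    (hF : CoeffContinuousOn F (bulkDomain T s))
    (h : ∀ p ∈ bulkInterior T s, |p 3| < 1 / 3 → PowerSeries.X ^ N ∣ F p)
    {q : Fin 4 → ℝ} (hq : q ∈ frontDomain T) : PowerSeries.X ^ N ∣ F (toBoundary q) := by
  simp only [PowerSeries.X_pow_dvd_iff] at h ⊢
  intro k hk
  have heq : Set.EqOn (fun p => PowerSeries.coeff k (F p)) (fun _ => 0)
      {p ∈ bulkInterior T s | |p 3| < 1 / 3} := fun p hp => h p hp.1 hp.2 k hk
  have hsub : insert (toBoundary q) {p ∈ bulkInterior T s | |p 3| < 1 / 3} ⊆ bulkDomain T s :=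
    Set.insert_subset (toBoundary_mem hq) fun p hp => bulkInterior_subset hp.1
  exact heq.of_subset_closure ((hF k).mono hsub) continuousOn_const (Set.subset_insert _ _)
    (Set.insert_subset (toBoundary_mem_closure hq) subset_closure) (Set.mem_insert _ _)

end Domains

/-! ### Regularity of the profile series and derivatives along the front. -/

section Derivatives

variable {T : ℝ} {s : Side}

theorem pd_zero {n : ℕ} {E : Type*} [NormedAddCommGroup E] [NormedSpace ℝ E] (D : Set (Fin n → ℝ))
    (i : Fin n) (p : Fin n → ℝ) : pd D i (0 : (Fin n → ℝ) → E) p = 0 := by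
  simp [pd]

theorem ContDiffOn.continuousOn_pd {n : ℕ} {E : Type*} [NormedAddCommGroup E] [NormedSpace ℝ E]
    {D : Set (Fin n → ℝ)} {f : (Fin n → ℝ) → E} (hf : ContDiffOn ℝ ∞ f D) (hD : UniqueDiffOn ℝ D)
    (i : Fin n) : ContinuousOn (pd D i f) D :=
  (hf.continuousOn_fderivWithin hD (by simp)).clm_apply continuousOn_const

theorem coeffContinuousOn_profileSeries {V : ℕ → (Fin 6 → ℝ) → Fin 7 → ℝ}
    (hV : ∀ n, ContDiffOn ℝ ∞ (V n) (bulkDomain T s)) (k : Fin 7) :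
    CoeffContinuousOn (fun p => profileSeries V p k) (bulkDomain T s) := fun n => by
  simpa only [profileSeries, vecSeries, PowerSeries.coeff_mk] using
    continuousOn_pi.mp (hV n).continuousOn k

theorem coeffContinuousOn_dProfileSeries (hT : 0 < T) {V : ℕ → (Fin 6 → ℝ) → Fin 7 → ℝ}
    (hV : ∀ n, ContDiffOn ℝ ∞ (V n) (bulkDomain T s)) (i : Fin 6) (k : Fin 7) :
    CoeffContinuousOn (fun p => dProfileSeries T s V p i k) (bulkDomain T s) := fun n => by
  simpa only [dProfileSeries, vecSeries, PowerSeries.coeff_mk] using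
    continuousOn_pi.mp ((hV n).continuousOn_pd (uniqueDiffOn_bulkDomain hT) i) k

theorem coeffContinuousOn_dFrontSeries (hT : 0 < T) {ψ : ℕ → (Fin 4 → ℝ) → ℝ}
    (hψ : ∀ n, ContDiffOn ℝ ∞ (ψ n) (frontDomain T)) (i : Fin 4) :
    CoeffContinuousOn (fun p => dFrontSeries T ψ (toFront p) i) (bulkDomain T s) := fun n => by
  simp only [dFrontSeries, PowerSeries.coeff_mk]
  have hc : Continuous toFront := by unfold toFront; fun_prop
  exact ((hψ n).continuousOn_pd (subset_closure_interior_frontDomain hT).2 i).comp hc.continuousOn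
    fun p hp => toFront_mem hp

/-- The double trace as a continuous linear map. -/
def toBoundaryCLM : (Fin 4 → ℝ) →L[ℝ] (Fin 6 → ℝ) :=
  ContinuousLinearMap.pi ![ContinuousLinearMap.proj 0, ContinuousLinearMap.proj 1,
    ContinuousLinearMap.proj 2, 0, 0, ContinuousLinearMap.proj 3]

theorem toBoundaryCLM_apply (q : Fin 4 → ℝ) : toBoundaryCLM q = toBoundary q := by
  ext i; fin_cases i <;> rfl

theorem toBoundaryCLM_single (i : Fin 4) :
    toBoundaryCLM (Pi.single i 1) = Pi.single (frontToBulkIdx i) 1 := by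
  rw [toBoundaryCLM_apply]
  ext k
  fin_cases i <;> fin_cases k <;> simp [toBoundary, frontToBulkIdx]

/-- The chain rule along the linear trace map: tangential derivatives commute with the double trace.
-/
theorem hasCoeffPd_profileSeries {V : ℕ → (Fin 6 → ℝ) → Fin 7 → ℝ}
    (hV : ∀ n, ContDiffOn ℝ ∞ (V n) (bulkDomain T s)) {q : Fin 4 → ℝ} (hq : q ∈ frontDomain T)
    (i : Fin 4) (k : Fin 7) :
    HasCoeffPd (frontDomain T) i (fun q => profileSeries V (toBoundary q) k)
      (dProfileSeries T s V (toBoundary q) (frontToBulkIdx i) k) q := fun n => by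
  have hd : HasFDerivWithinAt (V n) (fderivWithin ℝ (V n) (bulkDomain T s) (toBoundary q))
      (bulkDomain T s) (toBoundary q) :=
    ((hV n).differentiableOn (by simp) _ (toBoundary_mem hq)).hasFDerivWithinAt
  have hL : HasFDerivWithinAt toBoundary toBoundaryCLM (frontDomain T) q := by
    have := toBoundaryCLM.hasFDerivWithinAt (s := frontDomain T) (x := q)
    rwa [show (toBoundaryCLM : (Fin 4 → ℝ) → Fin 6 → ℝ) = toBoundary from
      funext toBoundaryCLM_apply] at this
  have hcomp := hd.comp q hL fun _ h => toBoundary_mem h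
  simp only [profileSeries, vecSeries, PowerSeries.coeff_mk]
  refine ⟨_, hasFDerivWithinAt_pi'.mp hcomp k, ?_⟩
  simp [dProfileSeries, vecSeries, pd, toBoundaryCLM_single]

/-- The series of the second derivatives of the fronts. -/
def ddFrontSeries (T : ℝ) (ψ : ℕ → (Fin 4 → ℝ) → ℝ) (q : Fin 4 → ℝ) (i k : Fin 4) : ℝ⟦X⟧ :=
  PowerSeries.mk fun n => pd (frontDomain T) i (pd (frontDomain T) k (ψ n)) q

theorem hasFDerivWithinAt_pd (hT : 0 < T) {f : (Fin 4 → ℝ) → ℝ}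
    (hf : ContDiffOn ℝ ∞ f (frontDomain T)) {q : Fin 4 → ℝ} (hq : q ∈ frontDomain T) (k : Fin 4) :
    HasFDerivWithinAt (pd (frontDomain T) k f)
      ((fderivWithin ℝ (fderivWithin ℝ f (frontDomain T)) (frontDomain T) q).flip (Pi.single k 1))
      (frontDomain T) q := by
  have hD := (subset_closure_interior_frontDomain hT).2
  have h1 : ContDiffOn ℝ ∞ (fderivWithin ℝ f (frontDomain T)) (frontDomain T) :=
    hf.fderivWithin hD (by simp)
  have h2 := (h1.differentiableOn (by simp) q hq).hasFDerivWithinAt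
  have h3 := h2.clm_apply (hasFDerivWithinAt_const (Pi.single k (1 : ℝ)) q (frontDomain T))
  rw [ContinuousLinearMap.comp_zero, zero_add] at h3
  exact h3

theorem hasCoeffPd_dFrontSeries (hT : 0 < T) {ψ : ℕ → (Fin 4 → ℝ) → ℝ}
    (hψ : ∀ n, ContDiffOn ℝ ∞ (ψ n) (frontDomain T)) {q : Fin 4 → ℝ} (hq : q ∈ frontDomain T)
    (i k : Fin 4) :
    HasCoeffPd (frontDomain T) i (fun q => dFrontSeries T ψ q k) (ddFrontSeries T ψ q i k) q :=
  fun n => by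
  have h := hasFDerivWithinAt_pd hT (hψ n) hq k
  refine ⟨_, by simpa only [dFrontSeries, PowerSeries.coeff_mk] using h, ?_⟩
  simp only [ddFrontSeries, PowerSeries.coeff_mk]
  rw [pd, h.fderivWithin ((subset_closure_interior_frontDomain hT).2 q hq)]

/-- Second derivatives within a set are symmetric at points that are limits of interior points, so
also at `t = 0` and `t = T`. -/
theorem ddFrontSeries_comm (hT : 0 < T) {ψ : ℕ → (Fin 4 → ℝ) → ℝ}
    (hψ : ∀ n, ContDiffOn ℝ ∞ (ψ n) (frontDomain T)) {q : Fin 4 → ℝ} (hq : q ∈ frontDomain T)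
    (i k : Fin 4) : ddFrontSeries T ψ q i k = ddFrontSeries T ψ q k i := by
  obtain ⟨hcl, hD⟩ := subset_closure_interior_frontDomain hT
  ext n
  simp only [ddFrontSeries, PowerSeries.coeff_mk]
  have hs := (hψ n q hq).isSymmSndFDerivWithinAt
    (by rw [minSmoothness_of_isRCLikeNormedField]; exact WithTop.coe_le_coe.mpr le_top) hD (hcl hq) hq
  rw [pd, pd, (hasFDerivWithinAt_pd hT (hψ n) hq k).fderivWithin (hD q hq),
    (hasFDerivWithinAt_pd hT (hψ n) hq i).fderivWithin (hD q hq)]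
  exact hs _ _

end Derivatives

/-! ### The trace identity and the conclusion. -/

/-- The identity for the trace of `F₆^{m,±}`, for families of smooth profiles which solve the cascade up to
the order `m` and vanish beyond. -/
theorem sourceF_normal_trace (P : SheetData) {χ : ℝ → ℝ} (hχ : IsCutoff χ) {T : ℝ} (hT : 0 < T)
    (s : Side) (m : ℕ) {V : ℕ → (Fin 6 → ℝ) → Fin 7 → ℝ} {ψ : ℕ → (Fin 4 → ℝ) → ℝ}
    (hV0 : V 0 = fun _ => P.refState s) (hV : ∀ n, ContDiffOn ℝ ∞ (V n) (bulkDomain T s))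
    (h0 : ψ 0 = 0) (h1 : ψ 1 = 0) (hψ : ∀ n, ContDiffOn ℝ ∞ (ψ n) (frontDomain T))
    (hVtop : V (m + 1) = 0) (hψtop : ψ (m + 2) = 0)
    (hfast : ∀ n < m, ∀ p ∈ bulkInterior T s, |p 3| < 1 / 3 →
      fastOp P T s (V (n + 1)) p = sourceF P χ T s ψ V n p)
    (hdiv : ∀ n < m, ∀ p ∈ bulkInterior T s, |p 3| < 1 / 3 →
      pd (bulkDomain T s) 4 (V (n + 1)) p 5
        + ∑ j : Fin 2, P.ξ j * pd (bulkDomain T s) 5 (V (n + 1)) p (HIdx j)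
        = sourceF8 P χ T s ψ V n p)
    (hu : ∀ n < m, ∀ q ∈ frontDomain T, V (n + 1) (toBoundary q) 2
      - P.c s * pd (frontDomain T) 3 (ψ (n + 2)) q = sourceG1 P T s ψ V n q)
    (hH : ∀ n < m, ∀ q ∈ frontDomain T, V (n + 1) (toBoundary q) 5
      - P.b s * pd (frontDomain T) 3 (ψ (n + 2)) q = sourceG2 P T s ψ V n q)
    {q : Fin 4 → ℝ} (hq : q ∈ frontDomain T) :
    sourceF P χ T s ψ V m (toBoundary q) 5
      = -(P.b s) * pd (frontDomain T) 3 (sourceG1 P T s ψ V m) q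
        + P.c s * pd (frontDomain T) 3 (sourceG2 P T s ψ V m) q := by
  have hD := (subset_closure_interior_frontDomain hT).2
  have hdV0 : ∀ i p, pd (bulkDomain T s) i (V 0) p = 0 := fun i p => by rw [hV0]; simp [pd]
  have hv : ∀ p k, k = 2 ∨ k = 5 → PowerSeries.X ∣ profileSeries V p k := by
    intro p k hk
    rw [PowerSeries.X_dvd_iff, ← PowerSeries.coeff_zero_eq_constantCoeff_apply, profileSeries,
      vecSeries, PowerSeries.coeff_mk, hV0]
    rcases hk with rfl | rfl <;> rfl
  have hdv : ∀ p i k, PowerSeries.X ∣ dProfileSeries T s V p i k := by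
    intro p i k
    rw [PowerSeries.X_dvd_iff, ← PowerSeries.coeff_zero_eq_constantCoeff_apply, dProfileSeries,
      vecSeries, PowerSeries.coeff_mk, hdV0, Pi.zero_apply]
  have hd : ∀ q i, PowerSeries.X ^ 2 ∣ dFrontSeries T ψ q i := by
    intro q i
    rw [PowerSeries.X_pow_dvd_iff]
    intro k hk
    rw [dFrontSeries, PowerSeries.coeff_mk]
    interval_cases k
    · rw [h0, pd_zero]
    · rw [h1, pd_zero]
  have hmag : ∀ β, PowerSeries.X ^ (m + 2) ∣ magResidual P β (profileSeries V (toBoundary q))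
      (dProfileSeries T s V (toBoundary q)) (dFrontSeries T ψ q) := by
    intro β
    have := X_pow_dvd_toBoundary (s := s) (N := m + 2)
      (.magResidual P β (coeffContinuousOn_profileSeries hV) (coeffContinuousOn_dProfileSeries hT hV)
        (coeffContinuousOn_dFrontSeries hT hψ)) (fun p hp hp3 => ?_) hq
    · simpa only [toFront_toBoundary] using this
    · refine X_pow_add_two_dvd (X_sq_dvd_magResidual β (hdv p) (hd _)) fun n hn => ?_
      have h := sourceF_magIdx P hχ T s ψ V n hp3 (by rw [hV0]) (fun i => hdV0 i p) β
      rw [← hfast n hn p hp hp3] at h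
      linarith
  have hdivu : PowerSeries.X ^ (m + 2) ∣ divResidual P velIdx
      (dProfileSeries T s V (toBoundary q)) (dFrontSeries T ψ q) := by
    have := X_pow_dvd_toBoundary (s := s) (N := m + 2)
      (.divResidual P velIdx (coeffContinuousOn_dProfileSeries hT hV)
        (coeffContinuousOn_dFrontSeries hT hψ)) (fun p hp hp3 => ?_) hq
    · simpa only [toFront_toBoundary] using this
    · refine X_pow_add_two_dvd (X_sq_dvd_divResidual _ (hdv p) (hd _)) fun n hn => ?_
      have h := sourceF_six P hχ T s ψ V n hp3
      rw [← hfast n hn p hp hp3] at h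
      linarith
  have hdivH : PowerSeries.X ^ (m + 2) ∣ divResidual P magIdx
      (dProfileSeries T s V (toBoundary q)) (dFrontSeries T ψ q) := by
    have := X_pow_dvd_toBoundary (s := s) (N := m + 2)
      (.divResidual P magIdx (coeffContinuousOn_dProfileSeries hT hV)
        (coeffContinuousOn_dFrontSeries hT hψ)) (fun p hp hp3 => ?_) hq
    · simpa only [toFront_toBoundary] using this
    · refine X_pow_add_two_dvd (X_sq_dvd_divResidual _ (hdv p) (hd _)) fun n hn => ?_
      have h := sourceF8_eq P hχ T s ψ V n hp3
      rw [← hdiv n hn p hp hp3] at h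
      linarith
  have hbu : ∀ q ∈ frontDomain T, PowerSeries.X ^ (m + 2) ∣
      bdryResidual P 1 velIdx (profileSeries V (toBoundary q)) (dFrontSeries T ψ q) := fun q hq =>
    X_pow_add_two_dvd (X_sq_dvd_bdryResidual _ _ (hv _ _ (Or.inl rfl)) (hd _)) fun n hn => by
      rw [coeff_bdryResidual_vel P T s ψ V n q (by rw [hV0]), hu n hn q hq, sub_self]
  have hbH : ∀ q ∈ frontDomain T, PowerSeries.X ^ (m + 2) ∣
      bdryResidual P 0 magIdx (profileSeries V (toBoundary q)) (dFrontSeries T ψ q) := fun q hq =>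
    X_pow_add_two_dvd (X_sq_dvd_bdryResidual _ _ (hv _ _ (Or.inr rfl)) (hd _)) fun n hn => by
      rw [coeff_bdryResidual_mag P T s ψ V n q (by rw [hV0]), hH n hn q hq, sub_self]
  -- With `V (m + 1)` and `ψ (m + 2)` zero, only the source survives in the first uncontrolled
  -- coefficient.
  have hcu : ∀ q, PowerSeries.coeff (m + 2)
      (bdryResidual P 1 velIdx (profileSeries V (toBoundary q)) (dFrontSeries T ψ q))
      = -sourceG1 P T s ψ V m q := fun q => by
    rw [coeff_bdryResidual_vel P T s ψ V m q (by rw [hV0]), hVtop, hψtop, pd_zero]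
    simp
  have hcH : ∀ q, PowerSeries.coeff (m + 2)
      (bdryResidual P 0 magIdx (profileSeries V (toBoundary q)) (dFrontSeries T ψ q))
      = -sourceG2 P T s ψ V m q := fun q => by
    rw [coeff_bdryResidual_mag P T s ψ V m q (by rw [hV0]), hVtop, hψtop, pd_zero]
    simp
  have hder : ∀ κ idx i k, PowerSeries.coeff k (dBdryResidual P κ idx
        (profileSeries V (toBoundary q)) (dProfileSeries T s V (toBoundary q)) (dFrontSeries T ψ q)
        (ddFrontSeries T ψ q) i)
      = pd (frontDomain T) i (fun q => PowerSeries.coeff k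
          (bdryResidual P κ idx (profileSeries V (toBoundary q)) (dFrontSeries T ψ q))) q :=
    fun κ idx i k => (HasCoeffPd.bdryResidual (fun k => hasCoeffPd_profileSeries hV hq i k)
      (fun k => hasCoeffPd_dFrontSeries hT hψ hq i k)).coeff_eq (hD q hq) k
  -- The boundary residuals are `O(X^{m+2})` on the whole front, hence so are their tangential
  -- derivatives.
  have hdvd : ∀ κ idx i, (∀ q ∈ frontDomain T, PowerSeries.X ^ (m + 2) ∣
        bdryResidual P κ idx (profileSeries V (toBoundary q)) (dFrontSeries T ψ q)) →
      PowerSeries.X ^ (m + 2) ∣ dBdryResidual P κ idx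
        (profileSeries V (toBoundary q)) (dProfileSeries T s V (toBoundary q)) (dFrontSeries T ψ q)
        (ddFrontSeries T ψ q) i := by
    intro κ idx i h
    rw [PowerSeries.X_pow_dvd_iff]
    intro k hk
    rw [hder, pd, fderivWithin_congr (f := fun _ => (0 : ℝ))
      (fun q hq => PowerSeries.X_pow_dvd_iff.mp (h q hq) k hk)
      (PowerSeries.X_pow_dvd_iff.mp (h q hq) k hk)]
    simp
  have hneg : ∀ (i : Fin 4) (f : (Fin 4 → ℝ) → ℝ),
      pd (frontDomain T) i (fun q => -f q) q = -pd (frontDomain T) i f q := fun i f => by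
    rw [pd, fderivWithin_fun_neg (hD q hq)]
    rfl
  have hmain := magResidual_normal_congr P (dd := ddFrontSeries T ψ q)
    (fun i k => ddFrontSeries_comm hT hψ hq i k) (hv (toBoundary q)) (hdv (toBoundary q)) (hd q)
    (fun k => hmag _) hdivu hdivH (hbu q hq) (hbH q hq)
  -- The gain of one power in `magResidual_normal_congr` is what reaches order `m + 2`, the first
  -- order not controlled by the cascade.
  have hcoef := PowerSeries.X_pow_dvd_iff.mp hmain (m + 2) (Nat.lt_succ_self _)
  have hX : ∀ F : ℝ⟦X⟧, PowerSeries.X ^ (m + 2) ∣ F →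
      PowerSeries.coeff (m + 2) (PowerSeries.X * F) = 0 := fun F hF => by
    rw [coeff_mul_of_X_pow_dvd hF]; simp
  have hdu := fun i => hdvd 1 velIdx i hbu
  have hdH := fun i => hdvd 0 magIdx i hbH
  have hsum : ∀ (a : ℝ) (F G : ℝ⟦X⟧), PowerSeries.X ^ (m + 2) ∣ F → PowerSeries.X ^ (m + 2) ∣ G →
      PowerSeries.X ^ (m + 2) ∣ PowerSeries.X * F + PowerSeries.C a * G := fun a F G hF hG =>
    dvd_add (hF.mul_left _) (hG.mul_left _)
  have hv0 : ∀ k, PowerSeries.coeff 0 (profileSeries V (toBoundary q) k) = P.refState s k :=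
    fun k => by rw [profileSeries, vecSeries, PowerSeries.coeff_mk, hV0]
  -- Slow derivatives carry an extra `X` and drop out, and the coefficients `u_j`, `H_j` enter
  -- through their reference values only. There remain `τ` and `ξ_j` times `θ`-derivatives of
  -- `-G₁^m` and `-G₂^m`.
  simp only [map_sub, map_add, PowerSeries.coeff_C_mul, hX _ (hdH _), hX _ (hdu _),
    coeff_mul_of_X_pow_dvd (hsum _ _ _ (hdH _) (hdH _)),
    coeff_mul_of_X_pow_dvd (hsum _ _ _ (hdu _) (hdu _)), hder, hcu, hcH, hneg, hv0,
    Fin.sum_univ_two] at hcoef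
  have hF := sourceF_magIdx P hχ T s ψ V m (p := toBoundary q) (by simp [toBoundary]) (by rw [hV0])
    (fun i => hdV0 i _) 2
  have hfast0 : fastOp P T s (V (m + 1)) (toBoundary q) = 0 := by
    simp [fastOp, hVtop, pd_zero]
  rw [hfast0, toFront_toBoundary] at hF
  have e0 : P.refState s 0 = P.u0 s 0 := rfl
  have e1 : P.refState s 1 = P.u0 s 1 := rfl
  have e3 : P.refState s 3 = P.H0 s 0 := rfl
  have e4 : P.refState s 4 = P.H0 s 1 := rfl
  simp only [show Fin.castSucc (0 : Fin 2) = 0 from rfl, show Fin.castSucc (1 : Fin 2) = 1 from rfl,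
    show velIdx 0 = 0 from rfl, show velIdx 1 = 1 from rfl, show magIdx 0 = 3 from rfl,
    show magIdx 1 = 4 from rfl, e0, e1, e3, e4] at hcoef
  rw [show magIdx 2 = 5 from rfl, Pi.zero_apply] at hF
  rw [hF, SheetData.b, SheetData.c, SheetData.a, Fin.sum_univ_two, Fin.sum_univ_two]
  linarith

/-- A front and its oscillating part have the same derivative in `θ`. -/
theorem pd_oscillating {T : ℝ} (hT : 0 < T) {Ψ Φ : (Fin 4 → ℝ) → ℝ}
    (hΨ : ContDiffOn ℝ ∞ Ψ (frontDomain T)) (hΦ : ContDiffOn ℝ ∞ Φ (frontDomain T))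
    (h : ∀ q ∈ frontDomain T, Ψ q - mean 3 Ψ q = Φ q) {q : Fin 4 → ℝ} (hq : q ∈ frontDomain T) :
    pd (frontDomain T) 3 Ψ q = pd (frontDomain T) 3 Φ q := by
  have hD := (subset_closure_interior_frontDomain hT).2 q hq
  have h1 := (hΨ.differentiableOn (by simp) q hq).hasFDerivWithinAt
  have h2 := (hΦ.differentiableOn (by simp) q hq).hasFDerivWithinAt
  set e : Fin 4 → ℝ := Pi.single 3 1
  have hline : HasDerivAt (fun x : ℝ => q + x • e) e 0 := by
    simpa using ((hasDerivAt_id (0 : ℝ)).smul_const e).const_add q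
  have hmem : ∀ x : ℝ, q + x • e ∈ frontDomain T := fun x => by
    simpa [frontDomain, e] using hq
  have hmean : ∀ x : ℝ, mean 3 Ψ (q + x • e) = mean 3 Ψ q := fun x => by
    have : ∀ y : ℝ, Function.update (q + x • e) 3 y = Function.update q 3 y := fun y => by
      ext k
      by_cases hk : k = 3
      · subst hk; simp
      · simp [hk, e]
    simp only [mean, this]
  have hq0 : q + (0 : ℝ) • e = q := by simp
  have h3 : HasDerivAt (fun x : ℝ => Ψ (q + x • e) - Φ (q + x • e))
      (fderivWithin ℝ Ψ (frontDomain T) q e - fderivWithin ℝ Φ (frontDomain T) q e) 0 := by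
    rw [← hq0] at h1 h2
    have k1 := h1.comp_hasDerivAt (0 : ℝ) hline (Filter.Eventually.of_forall hmem)
    have k2 := h2.comp_hasDerivAt (0 : ℝ) hline (Filter.Eventually.of_forall hmem)
    rw [hq0] at k1 k2
    exact k1.sub k2
  -- Along a line in `θ` the difference is a constant mean, so no differentiability of the mean in
  -- the other variables is needed.
  have h4 : (fun x : ℝ => Ψ (q + x • e) - Φ (q + x • e)) = fun _ => mean 3 Ψ q := by
    funext x
    rw [← h _ (hmem x), hmean]
    ring
  rw [h4] at h3
  have := h3.unique (hasDerivAt_const (0 : ℝ) (mean 3 Ψ q))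
  simp only [pd]
  linarith

theorem mainTheorem4 (P : SheetData) (hP : P.Admissible) (χ : ℝ → ℝ) (hχ : IsCutoff χ)
    (T : ℝ) (hT : 0 < T) (m : ℕ) (hm : 1 ≤ m) (W : Profiles) (hW : InductionHypothesis P χ T m W)
    (Ψ : (Fin 4 → ℝ) → ℝ) (hΨ : FrontHInf T Ψ)
    (hosc : ∀ q ∈ frontDomain T, Ψ q - mean 3 Ψ q = W.ψ (m + 1) q)
    (s : Side) (q : Fin 4 → ℝ) (hq : q ∈ frontDomain T) :
    (W.withFront (m + 1) Ψ).F P χ T s m (toBoundary q) 5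
      = -(P.b s) * pd (frontDomain T) 3
            (sourceG1 P T s (W.withFront (m + 1) Ψ).ψ ((W.withFront (m + 1) Ψ).U s) m) q
        + P.c s * pd (frontDomain T) 3
            (sourceG2 P T s (W.withFront (m + 1) Ψ).ψ ((W.withFront (m + 1) Ψ).U s) m) q := by
  -- The profiles of higher index in `W` are arbitrary. Truncation makes all coefficients smooth and
  -- turns the coefficients of order `m + 2` into the sources alone; by the congruence lemmas it
  -- does not change the sources at the points used.
  set V : ℕ → (Fin 6 → ℝ) → Fin 7 → ℝ := fun n => if n ≤ m then W.U s n else 0 with hVdef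
  set ψ : ℕ → (Fin 4 → ℝ) → ℝ := fun n =>
    if n ≤ m + 1 then Function.update W.ψ (m + 1) Ψ n else 0 with hψdef
  have hU : (W.withFront (m + 1) Ψ).U s = W.U s := rfl
  have hψ' : (W.withFront (m + 1) Ψ).ψ = Function.update W.ψ (m + 1) Ψ := rfl
  have hU0 : W.U s 0 = fun _ => P.refState s := by
    funext p
    simp [Profiles.U, hW.ref_res, hW.ref_surf]
  have hVle : ∀ n ≤ m, W.U s n = V n := fun n hn => by simp [hVdef, hn]
  have hψle : ∀ n ≤ m + 1, Function.update W.ψ (m + 1) Ψ n = ψ n := fun n hn => by simp [hψdef, hn]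
  have hψlt : ∀ n ≤ m, W.ψ n = ψ n := fun n hn => by
    rw [← hψle n (by omega), Function.update_of_ne (by omega)]
  have hW0 : W.ψ 0 = 0 := funext hW.front_zero
  have hW1 : W.ψ 1 = 0 := funext hW.front_one
  have h0 : ψ 0 = 0 := by rw [← hψlt 0 (by omega), hW0]
  -- Here `1 ≤ m` matters: the replaced front has index at least `2`.
  have h1 : ψ 1 = 0 := by rw [← hψlt 1 hm, hW1]
  have hdV0 : ∀ i p, pd (bulkDomain T s) i (W.U s 0) p = 0 := fun i p => by rw [hU0]; simp [pd]
  have hu0 : Function.update W.ψ (m + 1) Ψ 0 = 0 := by rw [hψle 0 (by omega), h0]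
  have hu1 : Function.update W.ψ (m + 1) Ψ 1 = 0 := by rw [hψle 1 (by omega), h1]
  have hVs : ∀ n, ContDiffOn ℝ ∞ (V n) (bulkDomain T s) := by
    intro n
    by_cases hn : n ≤ m
    · rw [← hVle n hn]
      rcases Nat.eq_zero_or_pos n with rfl | hpos
      · rw [hU0]; exact contDiffOn_const
      · exact (hW.mem_res s n hpos hn).smooth.add (hW.mem_surf s n hpos hn).smooth
    · simp only [hVdef, hn, if_false]
      exact contDiffOn_const
  have hψs : ∀ n, ContDiffOn ℝ ∞ (ψ n) (frontDomain T) := by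
    intro n
    rcases (by omega : n = 0 ∨ n = 1 ∨ (2 ≤ n ∧ n ≤ m) ∨ n = m + 1 ∨ m + 1 < n) with
      h | h | h | h | h
    · rw [h, h0]; exact contDiffOn_const
    · rw [h, h1]; exact contDiffOn_const
    · rw [← hψlt n h.2]
      exact (hW.mem_front n h.1 (by omega)).smooth
    · rw [← hψle n h.le, h, Function.update_self]
      exact hΨ.smooth
    · simp only [hψdef, not_le.mpr h, if_false]
      exact contDiffOn_const
  -- For `n < m` the sources involve fronts of index at most `m`. The front `ψ^{m+1}` enters only
  -- the jump relations with `n + 1 = m`, and there only through `∂_θ`, which ignores its mean.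
  have hθ : ∀ n < m, ∀ q ∈ frontDomain T,
      pd (frontDomain T) 3 (ψ (n + 2)) q = pd (frontDomain T) 3 (W.ψ (n + 2)) q := by
    intro n hn q hq
    rcases (by omega : n + 2 ≤ m ∨ n + 1 = m) with h | h
    · rw [hψlt _ h]
    · rw [← hψle _ (by omega), show n + 2 = m + 1 by omega, Function.update_self]
      exact pd_oscillating hT hΨ.smooth (hW.mem_front (m + 1) (by omega) le_rfl).smooth hosc hq
  have hG1 : ∀ n < m, sourceG1 P T s W.ψ (W.U s) n = sourceG1 P T s ψ V n := fun n hn =>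
    sourceG1_congr (fun l hl => hVle l (by omega)) (fun l hl => hψlt l (by omega)) hW0 hW1
  have hG2 : ∀ n < m, sourceG2 P T s W.ψ (W.U s) n = sourceG2 P T s ψ V n := fun n hn =>
    sourceG2_congr (fun l hl => hVle l (by omega)) (fun l hl => hψlt l (by omega)) hW0 hW1
  have hjump : ∀ n < m, ∀ q ∈ frontDomain T,
      (V (n + 1) (toBoundary q) 2 - P.c s * pd (frontDomain T) 3 (ψ (n + 2)) q
        = sourceG1 P T s ψ V n q) ∧
      (V (n + 1) (toBoundary q) 5 - P.b s * pd (frontDomain T) 3 (ψ (n + 2)) q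
        = sourceG2 P T s ψ V n q) := by
    intro n hn q hq
    have hj := hW.jump (n + 1) (by omega) hn q hq
    rw [← hG1 n hn, ← hG2 n hn, hθ n hn q hq, ← hVle _ hn]
    -- The first four rows decouple the two sides: rows `0`, `1` concern the plus side and rows `2`,
    -- `3` the minus side.
    have j0 := congrFun hj 0
    have j1 := congrFun hj 1
    have j2 := congrFun hj 2
    have j3 := congrFun hj 3
    simp [Bmat, SheetData.bVec, sourceG, dotProduct, Fin.sum_univ_succ] at j0 j1 j2 j3
    cases s
    · exact ⟨by linarith, by linarith⟩
    · exact ⟨by linarith, by linarith⟩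
  have hVtop : V (m + 1) = 0 := by simp [hVdef]
  have hψtop : ψ (m + 2) = 0 := by simp [hψdef]
  have hcong := sourceF_congr (P := P) (T := T) (s := s) (n := m) (p := toBoundary q) hχ
    (by simp [toBoundary]) hVle hψle hu0 hu1 (fun i => hdV0 i _)
  rw [Profiles.F, hU, hψ', hcong, sourceG1_congr hVle hψle hu0 hu1,
    sourceG2_congr hVle hψle hu0 hu1]
  refine sourceF_normal_trace P hχ hT s m (by rw [← hVle 0 (by omega), hU0]) hVs h0 h1 hψs hVtop hψtop
    ?_ ?_ (fun n hn q hq => (hjump n hn q hq).1) (fun n hn q hq => (hjump n hn q hq).2) hq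
  · intro n hn p hp hp3
    rw [← hVle _ hn, ← sourceF_congr hχ hp3 (fun l hl => hVle l (by omega))
      (fun l hl => hψlt l (by omega)) hW0 hW1 (fun i => hdV0 i p)]
    exact hW.fast (n + 1) (by omega) hn s p hp
  · intro n hn p hp hp3
    rw [← hVle _ hn, ← sourceF8_congr hχ hp3 (fun l hl => hVle l (by omega))
      (fun l hl => hψlt l (by omega)) hW0 hW1 (fun i => hdV0 i p)]
    exact hW.fast_div (n + 1) (by omega) hn s p hp

end
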